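/- Let $K=\mathbb{Q}(\alpha)$ be a number field generated by an element $\alpha$ with $\alpha^3+4\alpha-1=0$, with ring of integers $\mathcal{O}_K$. Let $P=(3,\,2+2\alpha+\alpha^2)\subseteq\mathcal{O}_K$ and $R=\mathbb{Z}+P^2$. An integral domain is called half-factorial (an HFD) if every nonzero nonunit is a product of irreducibles and any two factorizations of the same element into irreducibles have the same number of factors. Then: 1. $R$ is an order in $K$ whose integral closure in $K$ is $\mathcal{O}_K$. The ideal $P$ is prime, and the conductor $\{t\in\mathcal{O}_K : t\,\mathcal{O}_K\subseteq R\}$ of $R$ equals $P^2=(2-4\alpha+\alpha^2)$, which is not a radical ideal. 2. $R$ is an HFD, but the power series ring $R[[x]]$ is not an HFD. 3. The power series $f(x)=(6-12\alpha+3\alpha^2)+(1-2\alpha-4\alpha^2)x$ lies in $R[[x]]$ and is irreducible in $R[[x]]$, but in $\mathcal{O}_K[[x]]$ it factors as $f(x)=(3+\alpha x)(2-4\alpha+\alpha^2)$, where neither factor is a unit. -/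

import Mathlib

open scoped NumberField PowerSeries

/-- A half-factorial domain (HFD): an atomic integral domain in which any two factorizations of
the same element into irreducibles have the same number of factors. -/
structure IsHalfFactorialDomain (A : Type*) [CommRing A] : Prop where
  isDomain : IsDomain A
  atomic : ∀ a : A, a ≠ 0 → ¬ IsUnit a →
    ∃ s : Multiset A, (∀ p ∈ s, Irreducible p) ∧ s.prod = a
  length_eq : ∀ s t : Multiset A, (∀ p ∈ s, Irreducible p) → (∀ q ∈ t, Irreducible q) →
    s.prod = t.prod → Multiset.card s = Multiset.card t

/-- The subring `ℤ + I` of a commutative ring `T`, for an ideal `I` of `T`. -/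
def intAddIdeal {T : Type*} [CommRing T] (I : Ideal T) : Subring T where
  carrier := {x | ∃ n : ℤ, ∃ y ∈ I, x = (n : T) + y}
  mul_mem' := by
    rintro a b ⟨n, y, hy, rfl⟩ ⟨m, z, hz, rfl⟩
    refine ⟨n * m, n * z + y * (m + z),
      I.add_mem (I.mul_mem_left _ hz) (I.mul_mem_right _ hy), ?_⟩
    push_cast
    ring
  one_mem' := ⟨1, 0, I.zero_mem, by simp⟩
  add_mem' := by
    rintro a b ⟨n, y, hy, rfl⟩ ⟨m, z, hz, rfl⟩
    refine ⟨n + m, y + z, I.add_mem hy hz, ?_⟩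
    push_cast
    ring
  zero_mem' := ⟨0, 0, I.zero_mem, by simp⟩
  neg_mem' := by
    rintro a ⟨n, y, hy, rfl⟩
    refine ⟨-n, -y, I.neg_mem hy, ?_⟩
    push_cast
    ring

/-- The conductor ideal `(R : T) = {t ∈ T | t T ⊆ R}` of a subring `R` of `T`. -/
def conductorIdeal {T : Type*} [CommRing T] (R : Subring T) : Ideal T where
  carrier := {t | ∀ s : T, t * s ∈ R}
  add_mem' := by
    intro a b ha hb s
    rw [add_mul]
    exact R.add_mem (ha s) (hb s)
  zero_mem' := by
    intro s
    rw [zero_mul]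
    exact R.zero_mem
  smul_mem' := by
    intro c t ht s
    have h := ht (c * s)
    rwa [smul_eq_mul, mul_comm c t, mul_assoc]

/-- An order in a number field `K`: a subring of `K` that is finitely generated as a `ℤ`-module
and spans `K` over `ℚ`. -/
structure IsNumberFieldOrder {K : Type*} [Field K] [NumberField K] (R : Subring K) : Prop where
  fg : R.toAddSubgroup.FG
  span_eq_top : Submodule.span ℚ (R : Set K) = ⊤

/-- A root of `x³ + 4x - 1` in a number field is an algebraic integer. -/
theorem isIntegral_of_root {K : Type*} [Field K] [NumberField K] {α : K}
    (hα : α ^ 3 + 4 * α - 1 = 0) : IsIntegral ℤ α := by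
  refine ⟨Polynomial.X ^ 3 + (4 * Polynomial.X - 1), ?_, ?_⟩
  · monicity!
  · simp only [Polynomial.eval₂_add, Polynomial.eval₂_sub, Polynomial.eval₂_mul,
      Polynomial.eval₂_pow, Polynomial.eval₂_X, Polynomial.eval₂_one, Polynomial.eval₂_ofNat]
    linear_combination hα

/-- A root `α ∈ K` of `x³ + 4x - 1`, as an element of the ring of integers `𝓞 K`. -/
def rootInt {K : Type*} [Field K] [NumberField K] (α : K)
    (hα : α ^ 3 + 4 * α - 1 = 0) : 𝓞 K :=
  ⟨α, isIntegral_of_root hα⟩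

/-! Write b = 2 - 4a + a². The powers of a have discriminant -283, a prime up to sign, so they form
an integral basis of `𝓞 K`. Membership in P, in P² = (b) and in R then becomes a congruence on
coordinates: `𝓞 K`/P is the field with 9 elements, `𝓞 K`/P² has basis 1, a over ℤ/9, and R is the
preimage of ℤ/9.

The class group has order two and is generated by P. Minkowski's bound leaves only the primes over 2
and 3, whose classes are all powers of that of P (`classGroup_cubic`); and P is not principal
because b is not a unit times a square (`primeIdeal_not_isPrincipal`). Hence `𝓞 K` is
half-factorial: an irreducible generates either a principal prime or a product of two nonprincipal
primes, so `weight` counts factors. R inherits this because its irreducibles stay irreducible in `𝓞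
K` (`irreducible_coe`): some power of the unit a moves any element into R, so a factorization in `𝓞
K` can be pulled back to R, except when both factors lie in P; there the nonprincipality of P
decides.

Over power series such corrections by units fail. If Q is the other prime over 3, then (3b) = P³Q,
so the constant term of (3 + cx)b splits only as b times 3 up to units, and the coefficient of x
then forces c into ℤ + P (`mem_intAddIdeal_of_factorization`). Hence (3 + cx)b is irreducible over R
for c = a and c = 4 - a. The product of these two series is b · b · k with k over R, which has at
least three irreducible factors. -/

/-- The element `a` satisfies `a³ + 4a - 1 = 0`, and `1, a, a²` is a `ℤ`-basis of `T`. -/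
structure IsCubicGenerator {T : Type*} [CommRing T] (a : T) : Prop where
  root : a ^ 3 + 4 * a - 1 = 0
  exists_coord : ∀ x : T, ∃ u v w : ℤ, x = u + v * a + w * a ^ 2
  indep : ∀ u v w : ℤ, (u + v * a + w * a ^ 2 : T) = 0 → u = 0 ∧ v = 0 ∧ w = 0

/-! ### The integral basis, the discriminant and the unit rank. -/

section NumberField

open Polynomial Module

theorem irreducible_cubic_int : Irreducible (X ^ 3 + 4 * X - 1 : ℤ[X]) := by
  have hm : (X ^ 3 + 4 * X - 1 : ℤ[X]).Monic := by monicity!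
  -- 7 is the least prime modulo which the cubic has no root: -1 is a root modulo 2 and 3, and 2 is
  -- a root modulo 5.
  have h7 : ∀ x : ZMod 7, x ^ 3 + 4 * x - 1 ≠ 0 := by decide
  have : Fact (Nat.Prime 7) := ⟨by norm_num⟩
  refine Monic.irreducible_of_irreducible_map (Int.castRingHom (ZMod 7)) _ hm ?_
  have he : (X ^ 3 + 4 * X - 1 : ℤ[X]).map (Int.castRingHom (ZMod 7)) =
      X ^ 3 + 4 * X - 1 := by simp
  have hd : (X ^ 3 + 4 * X - 1 : (ZMod 7)[X]).natDegree = 3 := by compute_degree!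
  rw [he]
  refine irreducible_of_degree_le_three_of_not_isRoot (by rw [hd]; decide) fun x => ?_
  simp only [IsRoot.def, eval_sub, eval_add, eval_pow, eval_X, eval_mul, eval_ofNat, eval_one]
  exact h7 x

variable {K : Type*} [Field K] [NumberField K] {α : K}

theorem minpoly_cubic_root (hα : α ^ 3 + 4 * α - 1 = 0) :
    minpoly ℚ α = X ^ 3 + 4 * X - 1 := by
  have hm : (X ^ 3 + 4 * X - 1 : ℤ[X]).Monic := by monicity!
  have hi := (hm.irreducible_iff_irreducible_map_fraction_map (K := ℚ)).1 irreducible_cubic_int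
  have he : (X ^ 3 + 4 * X - 1 : ℤ[X]).map (algebraMap ℤ ℚ) = X ^ 3 + 4 * X - 1 := by simp
  rw [he] at hi
  refine (minpoly.eq_of_irreducible_of_monic hi ?_ (by monicity!)).symm
  simpa [map_ofNat] using hα

theorem exists_basis_cubic_root (hα : α ^ 3 + 4 * α - 1 = 0)
    (hK : IntermediateField.adjoin ℚ {α} = ⊤) :
    ∃ B : Basis (Fin 3) ℚ K, ∀ i, B i = α ^ (i : ℕ) := by
  have hint : IsIntegral ℚ α := Algebra.IsIntegral.isIntegral α
  have htop : Algebra.adjoin ℚ {α} = ⊤ :=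
    Algebra.adjoin_eq_top_of_primitive_element hint.isAlgebraic hK
  have hdim : (PowerBasis.ofAdjoinEqTop' hint htop).dim = 3 := by
    rw [PowerBasis.ofAdjoinEqTop'_dim, minpoly_cubic_root hα]
    compute_degree!
  refine ⟨(PowerBasis.ofAdjoinEqTop' hint htop).basis.reindex (finCongr hdim), fun i => ?_⟩
  rw [Basis.reindex_apply, PowerBasis.basis_eq_pow, PowerBasis.ofAdjoinEqTop'_gen]
  rfl

theorem finrank_cubic (hα : α ^ 3 + 4 * α - 1 = 0)
    (hK : IntermediateField.adjoin ℚ {α} = ⊤) : finrank ℚ K = 3 := by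
  obtain ⟨B, -⟩ := exists_basis_cubic_root hα hK
  simpa using finrank_eq_card_basis B

theorem trace_cubic_root (hα : α ^ 3 + 4 * α - 1 = 0)
    (hK : IntermediateField.adjoin ℚ {α} = ⊤) :
    Algebra.trace ℚ K α = 0 ∧ Algebra.trace ℚ K (α ^ 2) = -8 := by
  obtain ⟨B, hB⟩ := exists_basis_cubic_root hα hK
  have h3 : α ^ 3 = B 0 - (4 : ℚ) • B 1 := by
    rw [hB, hB, Algebra.smul_def]; simp; linear_combination hα
  have h4 : α ^ 4 = B 1 - (4 : ℚ) • B 2 := by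
    rw [hB, hB, Algebra.smul_def]; simp; linear_combination α * hα
  have e0 : α * B 0 = B 1 := by simp [hB]
  have e1 : α * B 1 = B 2 := by simp [hB]; ring
  have e2 : α * B 2 = B 0 - (4 : ℚ) • B 1 := by rw [← h3, hB]; simp; ring
  have f0 : α ^ 2 * B 0 = B 2 := by simp [hB]
  have f1 : α ^ 2 * B 1 = B 0 - (4 : ℚ) • B 1 := by rw [← h3, hB]; simp; ring
  have f2 : α ^ 2 * B 2 = B 1 - (4 : ℚ) • B 2 := by rw [← h4, hB]; simp; ring
  constructor
  · rw [Algebra.trace_eq_matrix_trace B, Matrix.trace_fin_three]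
    simp [Algebra.leftMulMatrix_eq_repr_mul, e0, e1, e2]
  · rw [Algebra.trace_eq_matrix_trace B, Matrix.trace_fin_three]
    simp [Algebra.leftMulMatrix_eq_repr_mul, f0, f1, f2]
    norm_num

theorem rootInt_root (hα : α ^ 3 + 4 * α - 1 = 0) :
    rootInt α hα ^ 3 + 4 * rootInt α hα - 1 = 0 :=
  (FaithfulSMul.algebraMap_injective (𝓞 K) K) (by
    rw [map_sub, map_add, map_pow, map_mul, map_ofNat, map_one, map_zero]
    exact hα)

theorem discr_powers_rootInt (hα : α ^ 3 + 4 * α - 1 = 0)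
    (hK : IntermediateField.adjoin ℚ {α} = ⊤) :
    Algebra.discr ℤ ![1, rootInt α hα, rootInt α hα ^ 2] = -283 := by
  obtain ⟨t1, t2⟩ := trace_cubic_root hα hK
  have hr := rootInt_root hα
  have hc : algebraMap (𝓞 K) K (rootInt α hα) = α := rfl
  set a := rootInt α hα
  have s0 : Algebra.trace ℤ (𝓞 K) 1 = 3 := by
    have : (Algebra.trace ℤ (𝓞 K) 1 : ℚ) = Algebra.trace ℚ K (algebraMap (𝓞 K) K 1) :=
      Algebra.coe_trace_int 1
    rw [map_one (algebraMap (𝓞 K) K), ← map_one (algebraMap ℚ K), Algebra.trace_algebraMap,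
      finrank_cubic hα hK, nsmul_eq_mul, mul_one] at this
    exact_mod_cast this
  have s1 : Algebra.trace ℤ (𝓞 K) a = 0 := by
    have : (Algebra.trace ℤ (𝓞 K) a : ℚ) =
        Algebra.trace ℚ K (algebraMap (𝓞 K) K a) := Algebra.coe_trace_int _
    rw [hc, t1] at this
    exact_mod_cast this
  have s2 : Algebra.trace ℤ (𝓞 K) (a ^ 2) = -8 := by
    have : (Algebra.trace ℤ (𝓞 K) (a ^ 2) : ℚ) =
        Algebra.trace ℚ K (algebraMap (𝓞 K) K (a ^ 2)) := Algebra.coe_trace_int _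
    rw [map_pow (algebraMap (𝓞 K) K), hc, t2] at this
    exact_mod_cast this
  have s3 : Algebra.trace ℤ (𝓞 K) (a ^ 3) = 3 := by
    rw [show a ^ 3 = 1 - (4 : ℤ) • a by rw [zsmul_eq_mul]; push_cast; linear_combination hr,
      map_sub, map_smul, s0, s1]
    norm_num
  have s4 : Algebra.trace ℤ (𝓞 K) (a ^ 4) = 32 := by
    rw [show a ^ 4 = a - (4 : ℤ) • a ^ 2 by rw [zsmul_eq_mul]; push_cast; linear_combination a * hr,
      map_sub, map_smul, s1, s2]
    norm_num
  rw [Algebra.discr_def, Matrix.det_fin_three]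
  simp only [Algebra.traceMatrix_apply, Algebra.traceForm_apply, Matrix.cons_val_zero,
    Matrix.cons_val_one, Matrix.cons_val, one_mul, mul_one]
  rw [show a * a = a ^ 2 by ring, show a * a ^ 2 = a ^ 3 by ring, show a ^ 2 * a = a ^ 3 by ring,
    show a ^ 2 * a ^ 2 = a ^ 4 by ring, s0, s1, s2, s3, s4]
  norm_num

/-- The square of the index of ℤ[α] divides 283, which is prime, so the index is 1. -/
theorem exists_integral_basis (hα : α ^ 3 + 4 * α - 1 = 0)
    (hK : IntermediateField.adjoin ℚ {α} = ⊤) :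
    ∃ B : Basis (Fin 3) ℤ (𝓞 K), ⇑B = ![1, rootInt α hα, rootInt α hα ^ 2] := by
  have hr : finrank ℤ (𝓞 K) = 3 := by rw [NumberField.RingOfIntegers.rank, finrank_cubic hα hK]
  let c : Basis (Fin 3) ℤ (𝓞 K) := finBasisOfFinrankEq ℤ (𝓞 K) hr
  set v := ![1, rootInt α hα, rootInt α hα ^ 2] with hv
  have hd : Algebra.discr ℤ v = (c.toMatrix v).det ^ 2 * Algebra.discr ℤ c := by
    rw [← Algebra.discr_of_matrix_vecMul, Basis.toMatrix_map_vecMul]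
  rw [discr_powers_rootInt hα hK] at hd
  have hu : IsUnit (c.det v) := by
    rw [Basis.det_apply]
    have h1 : (c.toMatrix v).det ^ 2 ∣ 283 := ⟨-Algebra.discr ℤ c, by linarith⟩
    generalize (c.toMatrix v).det = d at h1
    have h2 : d ∣ 283 := (Dvd.intro_left _ (by ring : d * d = d ^ 2)).trans h1
    have hp : Prime (283 : ℤ) := Int.prime_iff_natAbs_prime.2 (by norm_num)
    obtain ⟨e, he⟩ := h2
    rcases hp.irreducible.isUnit_or_isUnit he with h | h
    · exact h
    · rcases Int.isUnit_iff.1 h with rfl | rfl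
      · obtain rfl : d = 283 := by linarith
        norm_num at h1
      · obtain rfl : d = -283 := by linarith
        norm_num at h1
  obtain ⟨h1, h2⟩ := (Module.Basis.is_basis_iff_det c).2 hu
  exact ⟨Basis.mk h1 h2.ge, Basis.coe_mk h1 h2.ge⟩

theorem discr_cubic (hα : α ^ 3 + 4 * α - 1 = 0)
    (hK : IntermediateField.adjoin ℚ {α} = ⊤) : NumberField.discr K = -283 := by
  obtain ⟨B, hB⟩ := exists_integral_basis hα hK
  rw [← NumberField.discr_eq_discr K B, hB, discr_powers_rootInt hα hK]

theorem isCubicGenerator_rootInt (hα : α ^ 3 + 4 * α - 1 = 0)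
    (hK : IntermediateField.adjoin ℚ {α} = ⊤) : IsCubicGenerator (rootInt α hα) := by
  obtain ⟨B, hB⟩ := exists_integral_basis hα hK
  refine ⟨rootInt_root hα, fun x => ⟨B.repr x 0, B.repr x 1, B.repr x 2, ?_⟩, fun u v w h => ?_⟩
  · conv_lhs => rw [← B.sum_repr x, Fin.sum_univ_three]
    simp [hB]
  · have := Fintype.linearIndependent_iff.1 B.linearIndependent ![u, v, w]
      (by rw [Fin.sum_univ_three]; simpa [hB] using h)
    exact ⟨this 0, this 1, this 2⟩

/-- The sign of the discriminant is (-1)^r₂, so r₂ ≠ 0, and r₁ + 2r₂ = 3 leaves only r₂ = 1. -/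
theorem nrComplexPlaces_cubic (hα : α ^ 3 + 4 * α - 1 = 0)
    (hK : IntermediateField.adjoin ℚ {α} = ⊤) :
    NumberField.InfinitePlace.nrComplexPlaces K = 1 := by
  have h1 := NumberField.sign_discr K
  have h2 := NumberField.InfinitePlace.card_add_two_mul_card_eq_rank K
  rw [finrank_cubic hα hK] at h2
  rw [discr_cubic hα hK] at h1
  have h3 : NumberField.InfinitePlace.nrComplexPlaces K ≠ 0 := by
    intro h
    rw [h] at h1
    exact absurd h1 (by decide)
  omega

theorem units_rank_cubic (hα : α ^ 3 + 4 * α - 1 = 0)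
    (hK : IntermediateField.adjoin ℚ {α} = ⊤) : NumberField.Units.rank K = 1 := by
  have h1 := nrComplexPlaces_cubic hα hK
  have h2 := NumberField.InfinitePlace.card_add_two_mul_card_eq_rank K
  rw [finrank_cubic hα hK] at h2
  rw [NumberField.Units.rank, NumberField.InfinitePlace.card_eq_nrRealPlaces_add_nrComplexPlaces]
  omega

end NumberField

/-! ### Coordinate arithmetic: the ideals P and P², the order ℤ + P² and its conductor. -/

namespace IsCubicGenerator

variable {T : Type*} [CommRing T] {a : T}

theorem coord_unique (h : IsCubicGenerator a) {u v w u' v' w' : ℤ}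
    (e : (u + v * a + w * a ^ 2 : T) = u' + v' * a + w' * a ^ 2) :
    u = u' ∧ v = v' ∧ w = w' := by
  obtain ⟨h1, h2, h3⟩ := h.indep (u - u') (v - v') (w - w')
    (by push_cast; linear_combination e)
  exact ⟨by linarith, by linarith, by linarith⟩

theorem mul_coord (h : IsCubicGenerator a) (u v w u' v' w' : ℤ) :
    (u + v * a + w * a ^ 2 : T) * (u' + v' * a + w' * a ^ 2) =
      ((u * u' + (v * w' + w * v') : ℤ) : T) +
      ((u * v' + v * u' - 4 * (v * w' + w * v') + w * w' : ℤ) : T) * a +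
      ((u * w' + v * v' + w * u' - 4 * (w * w') : ℤ) : T) * a ^ 2 := by
  push_cast
  linear_combination (v * w' + w * v' + w * w' * a : T) * h.root

/-- A root `r` of `x³ + 4x - 1` in `S` determines a ring homomorphism sending `a` to `r`. -/
theorem exists_ringHom (h : IsCubicGenerator a) {S : Type*} [CommRing S] {r : S}
    (hr : r ^ 3 + 4 * r - 1 = 0) : ∃ φ : T →+* S, φ a = r := by
  choose u v w hx using h.exists_coord
  have key : ∀ (x : T) (u' v' w' : ℤ), x = u' + v' * a + w' * a ^ 2 →
      (u x + v x * r + w x * r ^ 2 : S) = u' + v' * r + w' * r ^ 2 := by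
    intro x u' v' w' e
    obtain ⟨h1, h2, h3⟩ := h.coord_unique ((hx x).symm.trans e)
    rw [h1, h2, h3]
  refine ⟨{ toFun := fun x => u x + v x * r + w x * r ^ 2
            map_one' := by simpa using key 1 1 0 0 (by simp)
            map_zero' := by simpa using key 0 0 0 0 (by simp)
            map_add' := fun x y => ?_
            map_mul' := fun x y => ?_ }, by simpa using key a 0 1 0 (by simp)⟩
  · rw [key (x * y) _ _ _ (by
      conv_lhs => rw [hx x, hx y]
      exact h.mul_coord _ _ _ _ _ _)]
    push_cast
    linear_combination -(v x * w y + w x * v y + w x * w y * r : S) * hr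
  · rw [key (x + y) (u x + u y) (v x + v y) (w x + w y)
      (by push_cast; linear_combination hx x + hx y)]
    push_cast
    ring

theorem isUnit (h : IsCubicGenerator a) : IsUnit a :=
  IsUnit.of_mul_eq_one (a ^ 2 + 4) (by linear_combination h.root)

/-- The prime `(3, 2 + 2a + a²)` above `3`. -/
def primeIdeal (a : T) : Ideal T := Ideal.span {3, 2 + 2 * a + a ^ 2}

/-- The generator `2 - 4a + a²` of the square of `(3, 2 + 2a + a²)`. -/
def squareGen (a : T) : T := 2 - 4 * a + a ^ 2

theorem three_mem : (3 : T) ∈ primeIdeal a := Ideal.subset_span (by simp)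

/-- Modulo P one has a² = a + 1 over 𝔽₃, so the two integers are the coordinates of the residue in
the basis 1, a. -/
theorem mem_primeIdeal_iff (h : IsCubicGenerator a) (u v w : ℤ) :
    (u + v * a + w * a ^ 2 : T) ∈ primeIdeal a ↔ 3 ∣ u + w ∧ 3 ∣ v + w := by
  rw [primeIdeal, Ideal.mem_span_pair]
  constructor
  · rintro ⟨x, y, e⟩
    obtain ⟨x0, x1, x2, rfl⟩ := h.exists_coord x
    obtain ⟨y0, y1, y2, rfl⟩ := h.exists_coord y
    have := h.coord_unique (u' := 3 * x0 + 2 * y0 + y1 + 2 * y2)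
      (v' := 3 * x1 + 2 * y0 - 2 * y1 - 7 * y2) (w' := 3 * x2 + y0 + 2 * y1 - 2 * y2)
      (e.symm.trans (by
        push_cast
        linear_combination (y1 + 2 * y2 + y2 * a) * h.root))
    omega
  · rintro ⟨⟨m, hm⟩, ⟨n, hn⟩⟩
    refine ⟨m - w + (n - w) * a, w, ?_⟩
    have hm' : (u + w : T) = 3 * m := by exact_mod_cast congrArg (Int.cast : ℤ → T) hm
    have hn' : (v + w : T) = 3 * n := by exact_mod_cast congrArg (Int.cast : ℤ → T) hn
    linear_combination -hm' - a * hn'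

/-- Since 9 is a multiple of b, the quotient is ℤ/9[a] with a² = 4a - 2, and the two integers are
the coordinates of the residue. -/
theorem mem_span_squareGen_iff (h : IsCubicGenerator a) (u v w : ℤ) :
    (u + v * a + w * a ^ 2 : T) ∈ Ideal.span {squareGen a} ↔ 9 ∣ u - 2 * w ∧ 9 ∣ v + 4 * w := by
  rw [Ideal.mem_span_singleton']
  constructor
  · rintro ⟨y, e⟩
    obtain ⟨y0, y1, y2, rfl⟩ := h.exists_coord y
    have := h.coord_unique (u' := 2 * y0 + y1 - 4 * y2)
      (v' := -4 * y0 - 2 * y1 + 17 * y2) (w' := y0 - 4 * y1 - 2 * y2)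
      (e.symm.trans (by
        rw [squareGen]
        push_cast
        linear_combination (y1 - 4 * y2 + y2 * a) * h.root))
    omega
  · rintro ⟨⟨m, hm⟩, ⟨n, hn⟩⟩
    refine ⟨w + (m + n * a) * (8 + a + 2 * a ^ 2), ?_⟩
    have hm' : (u - 2 * w : T) = 9 * m := by exact_mod_cast congrArg (Int.cast : ℤ → T) hm
    have hn' : (v + 4 * w : T) = 9 * n := by exact_mod_cast congrArg (Int.cast : ℤ → T) hn
    rw [squareGen]
    linear_combination -hm' - a * hn' + (m + n * a) * (2 * a - 7) * h.root

theorem squareGen_mul_cofactor (h : IsCubicGenerator a) :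
    squareGen a * (8 + a + 2 * a ^ 2) = 9 := by
  rw [squareGen]
  linear_combination (2 * a - 7) * h.root

theorem primeIdeal_sq (h : IsCubicGenerator a) :
    primeIdeal a ^ 2 = Ideal.span {squareGen a} := by
  apply le_antisymm
  · rw [pow_two, primeIdeal, Ideal.span_mul_span', Ideal.span_le]
    have h1 : ((9 : ℤ) + (0 : ℤ) * a + (0 : ℤ) * a ^ 2 : T) ∈ Ideal.span {squareGen a} :=
      (h.mem_span_squareGen_iff _ _ _).2 (by norm_num)
    have h2 : ((6 : ℤ) + (6 : ℤ) * a + (3 : ℤ) * a ^ 2 : T) ∈ Ideal.span {squareGen a} :=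
      (h.mem_span_squareGen_iff _ _ _).2 (by norm_num)
    have h3 : ((8 : ℤ) + (-7 : ℤ) * a + (4 : ℤ) * a ^ 2 : T) ∈ Ideal.span {squareGen a} :=
      (h.mem_span_squareGen_iff _ _ _).2 (by norm_num)
    rintro _ ⟨x, rfl | rfl, y, rfl | rfl, rfl⟩
    · rw [SetLike.mem_coe]; convert h1 using 1; push_cast; ring
    · rw [SetLike.mem_coe]; convert h2 using 1; push_cast; ring
    · rw [SetLike.mem_coe]; convert h2 using 1; push_cast; ring
    · rw [SetLike.mem_coe]; convert h3 using 1; push_cast; linear_combination (4 + a) * h.root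
  · rw [Ideal.span_singleton_le_iff_mem]
    have hq : (2 + 2 * a + a ^ 2 : T) ∈ primeIdeal a := Ideal.subset_span (by simp)
    -- Modulo 9 the square of 2 + 2a + a² equals 4b, and 7 inverts 4.
    have e : squareGen a = 7 * (2 + 2 * a + a ^ 2) ^ 2 - (7 * a + 3 * squareGen a) * 3 ^ 2 := by
      rw [squareGen]
      linear_combination -7 * (a + 4) * h.root
    rw [e]
    exact Ideal.sub_mem _ (Ideal.mul_mem_left _ _ (Ideal.pow_mem_pow hq 2))
      (Ideal.mul_mem_left _ _ (Ideal.pow_mem_pow three_mem 2))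

theorem mem_primeIdeal_sq_iff (h : IsCubicGenerator a) (u v w : ℤ) :
    (u + v * a + w * a ^ 2 : T) ∈ primeIdeal a ^ 2 ↔ 9 ∣ u - 2 * w ∧ 9 ∣ v + 4 * w := by
  rw [h.primeIdeal_sq, h.mem_span_squareGen_iff]

theorem squareGen_mem (h : IsCubicGenerator a) : squareGen a ∈ primeIdeal a ^ 2 := by
  rw [h.primeIdeal_sq]
  exact Ideal.mem_span_singleton_self _

theorem intCast_mem_primeIdeal_iff (h : IsCubicGenerator a) (n : ℤ) :
    (n : T) ∈ primeIdeal a ↔ 3 ∣ n := by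
  simpa using h.mem_primeIdeal_iff n 0 0

theorem sub_intCast_notMem_primeIdeal (h : IsCubicGenerator a) (n : ℤ) :
    a - n ∉ primeIdeal a := by
  have := (h.mem_primeIdeal_iff (-n) 1 0).not.2 (by omega)
  convert this using 2
  push_cast
  ring

theorem primeIdeal_isPrime (h : IsCubicGenerator a) : (primeIdeal a).IsPrime := by
  -- These are the coordinates of (A + Ba)(C + Da) in 𝔽₃[a] with a² = a + 1; the check says that
  -- this ring is a domain.
  have key : ∀ A B C D : ZMod 3, A * C + B * D = 0 → A * D + B * C + B * D = 0 →
      (A = 0 ∧ B = 0) ∨ (C = 0 ∧ D = 0) := by decide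
  refine ⟨fun ht => ?_, fun {x y} hxy => ?_⟩
  · have h1 : ((1 : ℤ) : T) ∈ primeIdeal a := by rw [ht]; trivial
    rw [h.intCast_mem_primeIdeal_iff] at h1
    omega
  · obtain ⟨u, v, w, rfl⟩ := h.exists_coord x
    obtain ⟨u', v', w', rfl⟩ := h.exists_coord y
    rw [h.mul_coord, h.mem_primeIdeal_iff] at hxy
    obtain ⟨e1, e2⟩ := hxy
    have d1 : ((u + w) * (u' + w') + (v + w) * (v' + w') : ZMod 3) = 0 := by
      rw [← (ZMod.intCast_zmod_eq_zero_iff_dvd _ 3).2 e1]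
      push_cast
      have : (3 : ZMod 3) = 0 := rfl
      linear_combination (2 * w * w') * this
    have d2 : ((u + w) * (v' + w') + (v + w) * (u' + w') + (v + w) * (v' + w') : ZMod 3) = 0 := by
      rw [← (ZMod.intCast_zmod_eq_zero_iff_dvd _ 3).2 e2]
      push_cast
      have : (3 : ZMod 3) = 0 := rfl
      linear_combination (2 * w * w' + 2 * (v * w' + w * v')) * this
    rw [h.mem_primeIdeal_iff, h.mem_primeIdeal_iff]
    have z : ∀ n : ℤ, 3 ∣ n ↔ (n : ZMod 3) = 0 := fun n =>
      (ZMod.intCast_zmod_eq_zero_iff_dvd n 3).symm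
    simp only [z, Int.cast_add]
    exact key _ _ _ _ d1 d2

/-- The order `ℤ + (3, 2 + 2a + a²)²`. -/
abbrev order (a : T) : Subring T := intAddIdeal (primeIdeal a ^ 2)

theorem mem_order_iff_exists {x : T} : x ∈ order a ↔ ∃ n : ℤ, x - n ∈ primeIdeal a ^ 2 :=
  ⟨fun ⟨n, y, hy, e⟩ => ⟨n, by rw [e, add_sub_cancel_left]; exact hy⟩,
    fun ⟨n, hn⟩ => ⟨n, _, hn, by ring⟩⟩

theorem mem_order_of_mem {x : T} (hx : x ∈ primeIdeal a ^ 2) : x ∈ order a :=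
  mem_order_iff_exists.2 ⟨0, by simpa using hx⟩

theorem mem_order_iff (h : IsCubicGenerator a) (u v w : ℤ) :
    (u + v * a + w * a ^ 2 : T) ∈ order a ↔ 9 ∣ v + 4 * w := by
  rw [mem_order_iff_exists]
  have e (n : ℤ) : (u + v * a + w * a ^ 2 - n : T) = ((u - n : ℤ) : T) + v * a + w * a ^ 2 := by
    push_cast; ring
  simp only [e, h.mem_primeIdeal_sq_iff]
  exact ⟨fun ⟨n, hn⟩ => hn.2, fun hv => ⟨u - 2 * w, by simp, hv⟩⟩

/-- The iterated map is multiplication by a on residues modulo P², in the basis 1, a over ℤ/9. A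
vanishing second coordinate means membership in the order. -/
theorem pow_mul_mem_order (h : IsCubicGenerator a) (k : ℕ) (u v w : ℤ)
    (hk : ((fun p : ZMod 9 × ZMod 9 => (-2 * p.2, p.1 + 4 * p.2))^[k]
      ((u - 2 * w : ℤ), (v + 4 * w : ℤ))).2 = 0) :
    a ^ k * (u + v * a + w * a ^ 2) ∈ order a := by
  induction k generalizing u v w with
  | zero =>
    rw [pow_zero, one_mul, h.mem_order_iff]
    exact (ZMod.intCast_zmod_eq_zero_iff_dvd _ 9).1 hk
  | succ k ih =>
    have e : a ^ (k + 1) * (u + v * a + w * a ^ 2) =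
        a ^ k * ((w : ℤ) + ((u - 4 * w : ℤ) : T) * a + (v : ℤ) * a ^ 2) := by
      push_cast
      linear_combination (a ^ k * w) * h.root
    rw [e]
    apply ih
    rw [Function.iterate_succ_apply] at hk
    convert hk using 4
    · push_cast
      have : (9 : ZMod 9) = 0 := rfl
      linear_combination w * this
    · push_cast
      have : (9 : ZMod 9) = 0 := rfl
      linear_combination -2 * w * this

/-- Every element of `T` has a unit multiple in the order. -/
theorem exists_unit_mul_mem_order (h : IsCubicGenerator a) (x : T) :
    ∃ ε : Tˣ, ε * x ∈ order a := by
  -- The units of T/P² number 72 and those of ℤ/9 number 6, so 12 consecutive powers of a are enough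
  -- to reach every class of the quotient group.
  have key : ∀ p : ZMod 9 × ZMod 9, ∃ k : Fin 12,
      ((fun p : ZMod 9 × ZMod 9 => (-2 * p.2, p.1 + 4 * p.2))^[k] p).2 = 0 := by decide +kernel
  obtain ⟨u, v, w, rfl⟩ := h.exists_coord x
  obtain ⟨k, hk⟩ := key ((u - 2 * w : ℤ), (v + 4 * w : ℤ))
  exact ⟨h.isUnit.unit ^ (k : ℕ), by simpa using h.pow_mul_mem_order k u v w hk⟩

/-- Outside P, an element of the order is congruent modulo P² to an integer prime to 3, which has an
integer inverse modulo 9. -/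
theorem mem_order_of_mul_mem (h : IsCubicGenerator a) {y z : T} (hy : y ∈ order a)
    (hyP : y ∉ primeIdeal a) (hyz : y * z ∈ order a) : z ∈ order a := by
  obtain ⟨n, p, hp, rfl⟩ := hy
  have hn : ¬ 3 ∣ n := fun hn => hyP (Ideal.add_mem _
    ((h.intCast_mem_primeIdeal_iff n).2 hn) (Ideal.pow_le_self two_ne_zero hp))
  have hc : IsCoprime n (3 ^ 2) :=
    ((Int.prime_three.coprime_iff_not_dvd.2 hn).symm).pow_right
  obtain ⟨s, t, e⟩ := hc
  have e' : (s * n + t * 3 ^ 2 : T) = 1 := by exact_mod_cast congrArg (Int.cast : ℤ → T) e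
  have hz : z = s * ((n + p) * z) + (t * z * 3 ^ 2 - s * z * p) := by
    linear_combination -z * e'
  rw [hz]
  exact (order a).add_mem ((order a).mul_mem (intCast_mem _ _) hyz)
    (mem_order_of_mem (Ideal.sub_mem _
      (Ideal.mul_mem_left _ _ (Ideal.pow_mem_pow three_mem 2)) (Ideal.mul_mem_left _ _ hp)))

theorem isUnit_coe_order (h : IsCubicGenerator a) {x : order a} :
    IsUnit (x : T) ↔ IsUnit x := by
  refine ⟨fun hx => ?_, fun hx => hx.map (order a).subtype⟩
  obtain ⟨y, hy⟩ := hx.exists_right_inv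
  have hxP : (x : T) ∉ primeIdeal a := fun hm =>
    h.primeIdeal_isPrime.ne_top (Ideal.eq_top_of_isUnit_mem _ hm hx)
  have hyR : y ∈ order a :=
    h.mem_order_of_mul_mem x.2 hxP (by rw [hy]; exact (order a).one_mem)
  exact IsUnit.of_mul_eq_one ⟨y, hyR⟩ (Subtype.ext hy)

theorem conductorIdeal_order (h : IsCubicGenerator a) :
    conductorIdeal (order a) = primeIdeal a ^ 2 := by
  ext t
  constructor
  · intro ht
    have h1 : t * 1 ∈ order a := ht 1
    -- Testing against 1 and a suffices: the two congruences together give both conditions for P².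
    have h2 : t * a ∈ order a := ht a
    obtain ⟨u, v, w, rfl⟩ := h.exists_coord t
    rw [mul_one, h.mem_order_iff] at h1
    rw [show (u + v * a + w * a ^ 2) * a =
        ((w : ℤ) + ((u - 4 * w : ℤ) : T) * a + (v : ℤ) * a ^ 2) by
      push_cast
      linear_combination w * h.root, h.mem_order_iff] at h2
    rw [h.mem_primeIdeal_sq_iff]
    omega
  · exact fun ht s => mem_order_of_mem (Ideal.mul_mem_right _ _ ht)

theorem primeIdeal_sq_not_isRadical (h : IsCubicGenerator a) :
    ¬ (primeIdeal a ^ 2).IsRadical := fun hr => by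
  have h3 : (3 : T) ∈ primeIdeal a ^ 2 := hr ⟨2, Ideal.pow_mem_pow three_mem 2⟩
  have := (h.mem_primeIdeal_sq_iff 3 0 0).1 (by simpa using h3)
  omega

theorem not_isUnit_three (h : IsCubicGenerator a) : ¬ IsUnit (3 : T) := fun hu =>
  h.primeIdeal_isPrime.ne_top (Ideal.eq_top_of_isUnit_mem _ three_mem hu)

theorem not_isUnit_squareGen (h : IsCubicGenerator a) : ¬ IsUnit (squareGen a) := fun hu =>
  h.primeIdeal_isPrime.ne_top
    (Ideal.eq_top_of_isUnit_mem _ (Ideal.pow_le_self two_ne_zero h.squareGen_mem) hu)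

theorem three_ne_zero (h : IsCubicGenerator a) : (3 : T) ≠ 0 := fun e => by
  have := h.indep 3 0 0 (by simpa using e)
  omega

theorem squareGen_ne_zero (h : IsCubicGenerator a) : squareGen a ≠ 0 := fun e => by
  have := h.indep 2 (-4) 1 (by rw [squareGen] at e; push_cast; linear_combination e)
  omega

end IsCubicGenerator

/-! ### Units modulo squares, and the nonprincipality of P. -/

section NumberField

open Module IsCubicGenerator

variable {K : Type*} [Field K] [NumberField K] {α : K}

theorem exists_fundamental_unit (hf : Odd (finrank ℚ K)) (hr : NumberField.Units.rank K = 1) :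
    ∃ η : (𝓞 K)ˣ, ∀ u : (𝓞 K)ˣ, ∃ n : ℤ, u = η ^ n ∨ u = -η ^ n := by
  let i0 : Fin (NumberField.Units.rank K) := ⟨0, by omega⟩
  have : Subsingleton (Fin (NumberField.Units.rank K)) := by rw [hr]; infer_instance
  refine ⟨NumberField.Units.fundSystem K i0, fun u => ?_⟩
  obtain ⟨⟨ζ, e⟩, he, -⟩ := NumberField.Units.exist_unique_eq_mul_prod K u
  simp only [Fintype.prod_subsingleton _ i0] at he
  refine ⟨e i0, ?_⟩
  rcases NumberField.Units.torsion_eq_one_or_neg_one_of_odd_finrank hf ζ with h | h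
  · left; rw [he, h, one_mul]
  · right; rw [he, h, neg_one_mul]

/-- It is not necessary to know that a is fundamental. Modulo 5, at the root 2, a is not ± a square,
so it is ± an odd power of the fundamental unit and represents the nontrivial class of units modulo
± squares. -/
theorem unit_eq_square_mul (hα : α ^ 3 + 4 * α - 1 = 0)
    (hK : IntermediateField.adjoin ℚ {α} = ⊤) (u : (𝓞 K)ˣ) :
    ∃ s : 𝓞 K, (u : 𝓞 K) = s ^ 2 ∨ (u : 𝓞 K) = -s ^ 2 ∨
      (u : 𝓞 K) = rootInt α hα * s ^ 2 ∨ (u : 𝓞 K) = -(rootInt α hα * s ^ 2) := by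
  have h := isCubicGenerator_rootInt hα hK
  set a := rootInt α hα
  obtain ⟨φ, hφ⟩ := h.exists_ringHom (S := ZMod 5) (r := 2) (by decide)
  have key : ∀ t : ZMod 5, 2 ≠ t ^ 2 ∧ 2 ≠ -t ^ 2 := by decide
  obtain ⟨η, hη⟩ := exists_fundamental_unit (K := K) (by rw [finrank_cubic hα hK]; decide)
    (units_rank_cubic hα hK)
  have hsq (n : ℤ) : (((η ^ (n + n) : (𝓞 K)ˣ)) : 𝓞 K) = ((η ^ n : (𝓞 K)ˣ) : 𝓞 K) ^ 2 := by
    rw [zpow_add, Units.val_mul, pow_two]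
  obtain ⟨m, hm⟩ := hη h.isUnit.unit
  have hmo : Odd m := by
    rw [← Int.not_even_iff_odd]
    rintro ⟨k, rfl⟩
    rcases hm with hm | hm <;> have hm := congrArg (fun x : (𝓞 K)ˣ => φ x) hm
    · simp only [IsUnit.unit_spec, hsq, hφ, map_pow] at hm
      exact (key _).1 hm
    · simp only [IsUnit.unit_spec, Units.val_neg, hsq, hφ, map_pow, map_neg] at hm
      exact (key _).2 hm
  obtain ⟨n, hn⟩ := hη u
  rcases Int.even_or_odd n with ⟨k, rfl⟩ | hno
  · refine ⟨((η ^ k : (𝓞 K)ˣ) : 𝓞 K), ?_⟩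
    rcases hn with rfl | rfl
    · exact Or.inl (hsq k)
    · exact Or.inr (Or.inl (by rw [Units.val_neg, hsq]))
  · obtain ⟨k, hk⟩ := hno.sub_odd hmo
    refine ⟨((η ^ k : (𝓞 K)ˣ) : 𝓞 K), Or.inr (Or.inr ?_)⟩
    have e : η ^ n = η ^ m * η ^ (k + k) := by rw [← zpow_add, ← hk]; congr 1; ring
    rw [← hsq, show a = (h.isUnit.unit : 𝓞 K) from rfl, ← Units.val_mul]
    rcases hm with hm | hm <;> rcases hn with hn | hn <;> simp [hm, hn, e]

/-- A generator γ would give b = uγ² with u a unit, so b would be ± a square or ± a times a square.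
Reduction at the root 2 modulo 5 sends b to the nonsquare 3 and excludes the first. Reduction at -2
modulo 17 sends a to a square and b to the nonsquare 14, which excludes the second; -1 is a square
modulo both primes. -/
theorem primeIdeal_not_isPrincipal (hα : α ^ 3 + 4 * α - 1 = 0)
    (hK : IntermediateField.adjoin ℚ {α} = ⊤) (γ : 𝓞 K) :
    primeIdeal (rootInt α hα) ≠ Ideal.span {γ} := by
  intro hP
  have h := isCubicGenerator_rootInt hα hK
  have hsq := unit_eq_square_mul hα hK
  set a := rootInt α hα
  obtain ⟨φ, hφ⟩ := h.exists_ringHom (S := ZMod 5) (r := 2) (by decide)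
  obtain ⟨ψ, hψ⟩ := h.exists_ringHom (S := ZMod 17) (r := -2) (by decide)
  have key : ∀ t : ZMod 5, t ^ 2 ≠ 2 - 4 * 2 + 2 ^ 2 ∧ -t ^ 2 ≠ 2 - 4 * 2 + 2 ^ 2 := by decide
  have key' : ∀ t : ZMod 17, -2 * t ^ 2 ≠ 2 - 4 * -2 + (-2) ^ 2 ∧
    -(-2 * t ^ 2) ≠ 2 - 4 * -2 + (-2) ^ 2 := by decide
  have h2 := h.primeIdeal_sq
  rw [hP, Ideal.span_singleton_pow, Ideal.span_singleton_eq_span_singleton] at h2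
  obtain ⟨u, hu⟩ := h2
  obtain ⟨s, hs | hs | hs | hs⟩ := hsq u <;> rw [hs, squareGen] at hu
  · have := congrArg φ hu
    simp only [map_mul, map_pow, map_sub, map_add, map_ofNat, hφ, ← mul_pow] at this
    exact (key _).1 this
  · have := congrArg φ hu
    simp only [map_mul, map_pow, map_sub, map_add, map_ofNat, hφ, map_neg, mul_neg,
      ← mul_pow] at this
    exact (key _).2 this
  · have := congrArg ψ hu
    rw [mul_left_comm, ← mul_pow] at this
    simp only [map_mul, map_pow, map_sub, map_add, map_ofNat, hψ] at this
    exact (key' _).1 this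
  · have := congrArg ψ hu
    rw [mul_neg, mul_left_comm, ← mul_pow] at this
    simp only [map_mul, map_pow, map_sub, map_add, map_ofNat, hψ, map_neg] at this
    exact (key' _).2 this

end NumberField

/-! ### Primes over 2 and 3, and relations between their classes. -/

namespace IsCubicGenerator

open nonZeroDivisors

variable {T : Type*} [CommRing T] {a : T}

theorem eq_span_of_add_one_mem (h : IsCubicGenerator a) {p : ℤ} (hp : Prime p) {q : Ideal T}
    (hq : q ≠ ⊤) (hpq : (p : T) ∈ q) (ha : a + 1 ∈ q) : q = Ideal.span {(p : T), a + 1} := by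
  apply le_antisymm
  · intro x hx
    obtain ⟨u, v, w, rfl⟩ := h.exists_coord x
    have e : (u + v * a + w * a ^ 2 : T) =
        ((u - v + w : ℤ) : T) + (v - w + w * a) * (a + 1) := by
      push_cast
      ring
    by_cases hd : p ∣ u - v + w
    · obtain ⟨m, hm⟩ := hd
      rw [e, hm]
      exact Ideal.mem_span_pair.2 ⟨m, v - w + w * a, by push_cast; ring⟩
    · exfalso
      obtain ⟨s, t, hst⟩ := (hp.coprime_iff_not_dvd).2 hd
      have hn : ((u - v + w : ℤ) : T) ∈ q := by
        rw [eq_sub_of_add_eq e.symm]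
        exact q.sub_mem hx (q.mul_mem_left _ ha)
      refine hq ((Ideal.eq_top_iff_one q).2 ?_)
      have h1 : (s * p + t * (u - v + w : ℤ) : T) = 1 := by
        exact_mod_cast congrArg (Int.cast : ℤ → T) hst
      rw [← h1]
      exact q.add_mem (q.mul_mem_left _ hpq) (q.mul_mem_left _ hn)
  · rw [Ideal.span_le, Set.pair_subset_iff]
    exact ⟨hpq, ha⟩

/-- Modulo 2 and a² + a + 1 every element reduces to 0, 1, a or a + 1. The last three cannot lie in
a proper ideal containing these generators, since a is a unit and a + 1 is congruent to -a². -/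
theorem eq_span_of_two_mem (h : IsCubicGenerator a) {q : Ideal T}
    (hq : q ≠ ⊤) (h2 : (2 : T) ∈ q) (ha : a ^ 2 + a + 1 ∈ q) :
    q = Ideal.span {2, a ^ 2 + a + 1} := by
  have haq : a ∉ q := fun hm => hq (Ideal.eq_top_of_isUnit_mem _ hm h.isUnit)
  have haq' : a + 1 ∉ q := fun hm => hq (Ideal.eq_top_of_isUnit_mem _ (by
    have := q.sub_mem ha hm
    rwa [show a ^ 2 + a + 1 - (a + 1) = a ^ 2 by ring] at this) (h.isUnit.pow 2))
  have h1 : (1 : T) ∉ q := fun hm => hq ((Ideal.eq_top_iff_one q).2 hm)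
  apply le_antisymm
  · intro x hx
    obtain ⟨u, v, w, rfl⟩ := h.exists_coord x
    have e : (u + v * a + w * a ^ 2 : T) =
        (((u - w : ℤ) : T) + ((v - w : ℤ) : T) * a) + w * (a ^ 2 + a + 1) := by
      push_cast
      ring
    have hx' : (((u - w : ℤ) : T) + ((v - w : ℤ) : T) * a) ∈ q := by
      rw [eq_sub_of_add_eq e.symm]
      exact q.sub_mem hx (q.mul_mem_left _ ha)
    rw [e]
    rcases Int.even_or_odd' (u - w) with ⟨m, hm | hm⟩ <;>
      rcases Int.even_or_odd' (v - w) with ⟨n, hn | hn⟩ <;> rw [hm, hn] at hx' ⊢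
    · exact Ideal.mem_span_pair.2 ⟨m + n * a, w, by push_cast; ring⟩
    · refine absurd ?_ haq
      convert q.sub_mem hx' (q.mul_mem_left (m + n * a) h2) using 1
      push_cast; ring
    · refine absurd ?_ h1
      convert q.sub_mem hx' (q.mul_mem_left (m + n * a) h2) using 1
      push_cast; ring
    · refine absurd ?_ haq'
      convert q.sub_mem hx' (q.mul_mem_left (m + n * a) h2) using 1
      push_cast; ring
  · rw [Ideal.span_le, Set.pair_subset_iff]
    exact ⟨h2, ha⟩

theorem span_two_mul_span_two (h : IsCubicGenerator a) :
    (Ideal.span {2, a ^ 2 + a + 1} * Ideal.span {((2 : ℤ) : T), a + 1} : Ideal T) =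
      Ideal.span {2} := by
  apply le_antisymm
  · rw [Ideal.span_mul_span', Ideal.span_le]
    rintro _ ⟨x, rfl | rfl, y, rfl | rfl, rfl⟩ <;>
      rw [SetLike.mem_coe, Ideal.mem_span_singleton']
    · exact ⟨2, by push_cast; ring⟩
    · exact ⟨a + 1, by push_cast; ring⟩
    · exact ⟨a ^ 2 + a + 1, by push_cast; ring⟩
    · exact ⟨a ^ 2 - a + 1, by linear_combination -h.root⟩
  · rw [Ideal.span_singleton_le_iff_mem]
    have h1 : (2 : T) ∈ Ideal.span {2, a ^ 2 + a + 1} := Ideal.subset_span (by simp)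
    have h2 : a ^ 2 + a + 1 ∈ Ideal.span {2, a ^ 2 + a + 1} := Ideal.subset_span (by simp)
    have h3 : ((2 : ℤ) : T) ∈ Ideal.span {((2 : ℤ) : T), a + 1} := Ideal.subset_span (by simp)
    have h4 : a + 1 ∈ Ideal.span {((2 : ℤ) : T), a + 1} := Ideal.subset_span (by simp)
    convert Ideal.sub_mem _ (Ideal.mul_mem_mul h2 h3)
      (Ideal.mul_mem_left _ a (Ideal.mul_mem_mul h1 h4)) using 1
    push_cast; ring

theorem span_two_mul_span_three (h : IsCubicGenerator a) :
    (Ideal.span {((2 : ℤ) : T), a + 1} * Ideal.span {((3 : ℤ) : T), a + 1} : Ideal T) =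
      Ideal.span {a + 1} := by
  apply le_antisymm
  · rw [Ideal.span_mul_span', Ideal.span_le]
    rintro _ ⟨x, rfl | rfl, y, rfl | rfl, rfl⟩ <;>
      rw [SetLike.mem_coe, Ideal.mem_span_singleton']
    · exact ⟨a ^ 2 - a + 5, by push_cast; linear_combination h.root⟩
    · exact ⟨2, by push_cast; ring⟩
    · exact ⟨3, by push_cast; ring⟩
    · exact ⟨a + 1, by ring⟩
  · rw [Ideal.span_singleton_le_iff_mem]
    have h1 : ((2 : ℤ) : T) ∈ Ideal.span {((2 : ℤ) : T), a + 1} := Ideal.subset_span (by simp)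
    have h2 : a + 1 ∈ Ideal.span {((2 : ℤ) : T), a + 1} := Ideal.subset_span (by simp)
    have h3 : ((3 : ℤ) : T) ∈ Ideal.span {((3 : ℤ) : T), a + 1} := Ideal.subset_span (by simp)
    have h4 : a + 1 ∈ Ideal.span {((3 : ℤ) : T), a + 1} := Ideal.subset_span (by simp)
    convert Ideal.sub_mem _ (Ideal.mul_mem_mul h2 h3) (Ideal.mul_mem_mul h1 h4) using 1
    push_cast; ring

theorem primeIdeal_mul_span_three (h : IsCubicGenerator a) :
    primeIdeal a * Ideal.span {((3 : ℤ) : T), a + 1} = Ideal.span {3} := by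
  apply le_antisymm
  · rw [primeIdeal, Ideal.span_mul_span', Ideal.span_le]
    rintro _ ⟨x, rfl | rfl, y, rfl | rfl, rfl⟩ <;>
      rw [SetLike.mem_coe, Ideal.mem_span_singleton']
    · exact ⟨3, by push_cast; ring⟩
    · exact ⟨a + 1, by ring⟩
    · exact ⟨2 + 2 * a + a ^ 2, by push_cast; ring⟩
    · exact ⟨a ^ 2 + 1, by linear_combination -h.root⟩
  · rw [Ideal.span_singleton_le_iff_mem]
    have h1 : (3 : T) ∈ primeIdeal a := Ideal.subset_span (by simp)
    have h2 : 2 + 2 * a + a ^ 2 ∈ primeIdeal a := Ideal.subset_span (by simp)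
    have h3 : ((3 : ℤ) : T) ∈ Ideal.span {((3 : ℤ) : T), a + 1} := Ideal.subset_span (by simp)
    have h4 : a + 1 ∈ Ideal.span {((3 : ℤ) : T), a + 1} := Ideal.subset_span (by simp)
    convert Ideal.add_mem _ (Ideal.sub_mem _ (Ideal.mul_mem_mul h2 h4) (Ideal.mul_mem_mul h2 h3))
      (Ideal.mul_mem_left _ 2 (Ideal.mul_mem_mul h1 h4)) using 1
    push_cast; linear_combination -h.root

theorem primeIdeal_ne_zero (h : IsCubicGenerator a) : primeIdeal a ≠ ⊥ := fun e =>
  h.three_ne_zero (by simpa [e] using three_mem (a := a))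

variable [IsDedekindDomain T]

theorem mk0_mul_mk0_eq_one {I J : (Ideal T)⁰} {x : T} (e : (I * J : Ideal T) = Ideal.span {x}) :
    ClassGroup.mk0 I * ClassGroup.mk0 J = 1 := by
  rw [← map_mul, ClassGroup.mk0_eq_one_iff, Submonoid.coe_mul, e]
  exact ⟨x, rfl⟩

/-- The class of `(3, 2 + 2a + a²)`. -/
noncomputable def primeClass (h : IsCubicGenerator a) : ClassGroup T :=
  ClassGroup.mk0 ⟨primeIdeal a, mem_nonZeroDivisors_of_ne_zero h.primeIdeal_ne_zero⟩

theorem primeClass_mul_self (h : IsCubicGenerator a) : h.primeClass * h.primeClass = 1 :=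
  mk0_mul_mk0_eq_one (x := squareGen a) (by rw [← h.primeIdeal_sq, pow_two])

/-- The cubic factors as (x + 1)(x² + x + 1) modulo 2 and as (x + 1)(x² + 2x + 2) modulo 3, which
lists the primes. The relations with principal products (3), (a + 1) and (2) express each class in
turn through that of P. -/
theorem mk0_mem_zpowers_of_isPrime (h : IsCubicGenerator a) {q : (Ideal T)⁰}
    (hq : (q : Ideal T).IsPrime) (hm : (2 : T) ∈ (q : Ideal T) ∨ (3 : T) ∈ (q : Ideal T)) :
    ClassGroup.mk0 q ∈ Subgroup.zpowers h.primeClass := by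
  have h30 := h.three_ne_zero
  have h20 : (2 : T) ≠ 0 := fun e => by
    have := h.indep 2 0 0 (by simpa using e)
    omega
  have nz : ∀ {I : Ideal T} {x : T}, x ≠ 0 → x ∈ I → I ∈ (Ideal T)⁰ := fun hx hI =>
    mem_nonZeroDivisors_of_ne_zero fun e => hx (by simpa [e] using hI)
  let Q3 : (Ideal T)⁰ := ⟨Ideal.span {((3 : ℤ) : T), a + 1},
    nz h30 (Ideal.subset_span (by simp))⟩
  let Q2 : (Ideal T)⁰ := ⟨Ideal.span {((2 : ℤ) : T), a + 1},
    nz h20 (Ideal.subset_span (by simp))⟩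
  let Q4 : (Ideal T)⁰ := ⟨Ideal.span {(2 : T), a ^ 2 + a + 1},
    nz h20 (Ideal.subset_span (by simp))⟩
  have m3 : ClassGroup.mk0 Q3 ∈ Subgroup.zpowers h.primeClass := by
    have : h.primeClass * ClassGroup.mk0 Q3 = 1 := mk0_mul_mk0_eq_one h.primeIdeal_mul_span_three
    rw [eq_inv_of_mul_eq_one_right this]
    exact inv_mem (Subgroup.mem_zpowers _)
  have m2 : ClassGroup.mk0 Q2 ∈ Subgroup.zpowers h.primeClass := by
    have : ClassGroup.mk0 Q2 * ClassGroup.mk0 Q3 = 1 :=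
      mk0_mul_mk0_eq_one h.span_two_mul_span_three
    rw [eq_inv_of_mul_eq_one_left this]
    exact inv_mem m3
  have m4 : ClassGroup.mk0 Q4 ∈ Subgroup.zpowers h.primeClass := by
    have : ClassGroup.mk0 Q4 * ClassGroup.mk0 Q2 = 1 :=
      mk0_mul_mk0_eq_one h.span_two_mul_span_two
    rw [eq_inv_of_mul_eq_one_left this]
    exact inv_mem m2
  rcases hm with hm | hm
  · have : (a + 1) * (a ^ 2 + a + 1) ∈ (q : Ideal T) := by
      rw [show (a + 1) * (a ^ 2 + a + 1) = (a ^ 2 - a + 1) * 2 by linear_combination h.root]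
      exact Ideal.mul_mem_left _ _ hm
    rcases hq.mem_or_mem this with h1 | h1
    · rwa [show q = Q2 from Subtype.ext (h.eq_span_of_add_one_mem Int.prime_two hq.ne_top
        (by simpa using hm) h1)]
    · rwa [show q = Q4 from Subtype.ext (h.eq_span_of_two_mem hq.ne_top hm h1)]
  · have : (a + 1) * (2 + 2 * a + a ^ 2) ∈ (q : Ideal T) := by
      rw [show (a + 1) * (2 + 2 * a + a ^ 2) = (a ^ 2 + 1) * 3 by linear_combination h.root]
      exact Ideal.mul_mem_left _ _ hm
    rcases hq.mem_or_mem this with h1 | h1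
    · rwa [show q = Q3 from Subtype.ext (h.eq_span_of_add_one_mem Int.prime_three hq.ne_top
        (by simpa using hm) h1)]
    · have hle : primeIdeal a ≤ q := by
        rw [primeIdeal, Ideal.span_le, Set.pair_subset_iff]
        exact ⟨hm, h1⟩
      have := (h.primeIdeal_isPrime.isMaximal h.primeIdeal_ne_zero).eq_of_le hq.ne_top hle
      rw [show q = ⟨primeIdeal a, mem_nonZeroDivisors_of_ne_zero h.primeIdeal_ne_zero⟩ from
        Subtype.ext this.symm]
      exact Subgroup.mem_zpowers _

theorem mk0_mem_zpowers (h : IsCubicGenerator a) (I : Ideal T) (hI : I ≠ ⊥)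
    (hq : ∀ q : Ideal T, q.IsPrime → I ≤ q → (2 : T) ∈ q ∨ (3 : T) ∈ q) :
    ClassGroup.mk0 ⟨I, mem_nonZeroDivisors_of_ne_zero hI⟩ ∈ Subgroup.zpowers h.primeClass := by
  induction I using UniqueFactorizationMonoid.induction_on_prime with
  | h₁ => exact absurd rfl hI
  | h₂ I hu =>
    have : I = ⊤ := Ideal.isUnit_iff.1 hu
    rw [(ClassGroup.mk0_eq_one_iff _).2 ⟨1, by simp [this]⟩]
    exact one_mem _
  | h₃ I p hI0 hp ih =>
    have hpp := Ideal.isPrime_of_prime hp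
    have e : (⟨p * I, mem_nonZeroDivisors_of_ne_zero hI⟩ : (Ideal T)⁰) =
      ⟨p, mem_nonZeroDivisors_of_ne_zero hp.ne_zero⟩ *
        ⟨I, mem_nonZeroDivisors_of_ne_zero hI0⟩ := rfl
    rw [e, map_mul]
    exact mul_mem (h.mk0_mem_zpowers_of_isPrime hpp (hq p hpp Ideal.mul_le_left))
      (ih hI0 fun q hqq hIq => hq q hqq (Ideal.mul_le_right.trans hIq))

end IsCubicGenerator

/-! ### The class group via Minkowski's bound. -/

section NumberField

open IsCubicGenerator nonZeroDivisors

variable {K : Type*} [Field K] [NumberField K] {α : K}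

theorem minkowskiBound_cubic (hα : α ^ 3 + 4 * α - 1 = 0)
    (hK : IntermediateField.adjoin ℚ {α} = ⊤) (n : ℕ)
    (hn : n ≤ (4 / Real.pi) ^ NumberField.InfinitePlace.nrComplexPlaces K *
      ((Module.finrank ℚ K).factorial / (Module.finrank ℚ K) ^ (Module.finrank ℚ K) *
        √|NumberField.discr K|)) : n ≤ 4 := by
  rw [nrComplexPlaces_cubic hα hK, finrank_cubic hα hK, discr_cubic hα hK] at hn
  have hs : √(|(-283 : ℤ)| : ℝ) ≤ 17 := by
    rw [Real.sqrt_le_left (by norm_num)]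
    norm_num
  have hp : 4 / Real.pi ≤ 4 / 3.14 := by
    gcongr
    exact Real.pi_gt_d2.le
  have : (n : ℝ) < 5 := by
    refine hn.trans_lt ?_
    calc _ ≤ (4 / 3.14) ^ 1 * (((3).factorial : ℝ) / (3 : ℕ) ^ 3 * 17) := by gcongr
      _ < 5 := by norm_num [Nat.factorial]
  have : n < 5 := by exact_mod_cast this
  omega

theorem classGroup_cubic (hα : α ^ 3 + 4 * α - 1 = 0)
    (hK : IntermediateField.adjoin ℚ {α} = ⊤) (C : ClassGroup (𝓞 K)) :
    C = 1 ∨ C = (isCubicGenerator_rootInt hα hK).primeClass := by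
  have h := isCubicGenerator_rootInt hα hK
  obtain ⟨⟨I, hI⟩, rfl, hn⟩ := NumberField.exists_ideal_in_class_of_norm_le C
  have hn' : Ideal.absNorm I ≤ 4 := minkowskiBound_cubic hα hK _ (by simpa [mul_assoc] using hn)
  have hI0 : I ≠ ⊥ := nonZeroDivisors.ne_zero hI
  have hm := h.mk0_mem_zpowers I hI0 fun q hq hIq => by
    have h1 : ((Ideal.absNorm I : ℕ) : 𝓞 K) ∈ q := hIq (Ideal.absNorm_mem I)
    have h0 : Ideal.absNorm I ≠ 0 := Ideal.absNorm_eq_zero_iff.not.2 hI0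
    generalize Ideal.absNorm I = m at hn' h1 h0
    interval_cases m
    · exact absurd rfl h0
    · exact absurd ((Ideal.eq_top_iff_one q).2 (by simpa using h1)) hq.ne_top
    · exact Or.inl (by simpa using h1)
    · exact Or.inr (by simpa using h1)
    · left
      refine hq.mem_of_pow_mem 2 ?_
      convert h1 using 1
      norm_num
  obtain ⟨k, hk⟩ := Subgroup.mem_zpowers_iff.1 hm
  rw [← hk]
  have h2 := h.primeClass_mul_self
  rcases Int.even_or_odd' k with ⟨m, rfl | rfl⟩
  · left; rw [zpow_mul, zpow_two, h2, one_zpow]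
  · right; rw [zpow_add, zpow_mul, zpow_two, h2, one_zpow, one_mul, zpow_one]

theorem isPrincipal_mul_of_not_isPrincipal (hα : α ^ 3 + 4 * α - 1 = 0)
    (hK : IntermediateField.adjoin ℚ {α} = ⊤) {I J : Ideal (𝓞 K)}
    (hI : ¬ I.IsPrincipal) (hJ : ¬ J.IsPrincipal) : (I * J).IsPrincipal := by
  have nz : ∀ {L : Ideal (𝓞 K)}, ¬ L.IsPrincipal → L ≠ ⊥ := fun hL e => hL (e ▸ bot_isPrincipal)
  have key : ∀ L : (Ideal (𝓞 K))⁰, ¬ (L : Ideal (𝓞 K)).IsPrincipal →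
      ClassGroup.mk0 L = (isCubicGenerator_rootInt hα hK).primeClass := fun L hL =>
    (classGroup_cubic hα hK _).resolve_left fun e => hL ((ClassGroup.mk0_eq_one_iff L.2).1 e)
  have h1 := key ⟨I, mem_nonZeroDivisors_of_ne_zero (nz hI)⟩ hI
  have h2 := key ⟨J, mem_nonZeroDivisors_of_ne_zero (nz hJ)⟩ hJ
  refine (ClassGroup.mk0_eq_one_iff (I := I * J)
    (mem_nonZeroDivisors_of_ne_zero (mul_ne_zero (nz hI) (nz hJ)))).1 ?_
  have := (isCubicGenerator_rootInt hα hK).primeClass_mul_self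
  conv at this => lhs; congr; { rw [← h1] }; { rw [← h2] }
  rw [← map_mul] at this
  exact this

end NumberField

/-! ### Half-factoriality when any two nonprincipal ideals have a principal product. -/

section ClassNumberTwo

open UniqueFactorizationMonoid

variable {T : Type*} [CommRing T] [IsDedekindDomain T]

open scoped Classical in
/-- The number of prime factors of the ideal `(x)`, where principal primes count twice. -/
noncomputable def weight (x : T) : ℕ :=
  ((normalizedFactors (Ideal.span {x})).map fun q => if q.IsPrincipal then 2 else 1).sum

theorem weight_mul {x y : T} (hx : x ≠ 0) (hy : y ≠ 0) :
    weight (x * y) = weight x + weight y := by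
  rw [weight, ← Ideal.span_singleton_mul_span_singleton,
    normalizedFactors_mul (by simpa) (by simpa),
    Multiset.map_add, Multiset.sum_add]
  rfl

theorem weight_one : weight (1 : T) = 0 := by
  rw [weight, Ideal.span_singleton_one, ← Ideal.one_eq_top, normalizedFactors_one]
  rfl

theorem Irreducible.span_eq_of_isPrincipal {x : T} (hx : Irreducible x) {I : Ideal T}
    (hI : I.IsPrincipal) (hI1 : I ≠ ⊤) (hd : I ∣ Ideal.span {x}) : Ideal.span {x} = I := by
  obtain ⟨y, rfl⟩ := hI
  change Ideal.span {y} ∣ _ at hd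
  change Ideal.span {y} ≠ _ at hI1
  rw [Ideal.dvd_span_singleton, Ideal.mem_span_singleton] at hd
  obtain ⟨z, rfl⟩ := hd
  rcases hx.isUnit_or_isUnit rfl with h | h
  · exact absurd (Ideal.span_singleton_eq_top.2 h) hI1
  · exact Ideal.span_singleton_mul_right_unit h y

/-- If a principal prime divides (x), it equals (x). Otherwise two nonprincipal primes divide it,
and their product is a proper principal divisor, hence equals (x). The weight is 2 in both cases. -/
theorem weight_irreducible (h2 : ∀ I J : Ideal T, ¬ I.IsPrincipal → ¬ J.IsPrincipal →
    (I * J).IsPrincipal) {x : T} (hx : Irreducible x) : weight x = 2 := by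
  have one : ∀ q : Ideal T, Prime q → q ∣ Ideal.span {x} → q.IsPrincipal → weight x = 2 := by
    intro q hq hd hqp
    rw [weight, hx.span_eq_of_isPrincipal hqp (Ideal.isPrime_of_prime hq).ne_top hd,
      normalizedFactors_irreducible hq.irreducible]
    simp [hqp]
  have hx0 : Ideal.span {x} ≠ ⊥ := by simpa using hx.ne_zero
  have hxu : ¬ IsUnit (Ideal.span {x}) := by
    rw [Ideal.isUnit_iff, Ideal.span_singleton_eq_top]
    exact hx.not_isUnit
  obtain ⟨q, hq, J, hJ⟩ := WfDvdMonoid.exists_irreducible_factor hxu hx0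
  by_cases hqp : q.IsPrincipal
  · exact one q hq.prime ⟨J, hJ⟩ hqp
  have hJ0 : J ≠ ⊥ := fun e => hx0 (by rw [hJ, e, Ideal.mul_bot])
  have hJu : ¬ IsUnit J := fun hu => hqp (by
    rw [Ideal.isUnit_iff] at hu
    rw [hu, Ideal.mul_top] at hJ
    exact ⟨x, hJ.symm⟩)
  obtain ⟨r, hr, M, hM⟩ := WfDvdMonoid.exists_irreducible_factor hJu hJ0
  by_cases hrp : r.IsPrincipal
  · exact one r hr.prime ⟨q * M, by rw [hJ, hM, mul_left_comm]⟩ hrp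
  have htop : q * r ≠ ⊤ := fun e => (Ideal.isPrime_of_prime hq.prime).ne_top
    (top_le_iff.1 (e ▸ Ideal.mul_le_left))
  rw [weight, hx.span_eq_of_isPrincipal (h2 q r hqp hrp) htop ⟨M, by rw [hJ, hM, mul_assoc]⟩,
    normalizedFactors_mul hq.ne_zero hr.ne_zero, normalizedFactors_irreducible hq,
    normalizedFactors_irreducible hr]
  simp [hqp, hrp]

theorem weight_prod (h2 : ∀ I J : Ideal T, ¬ I.IsPrincipal → ¬ J.IsPrincipal →
    (I * J).IsPrincipal) (s : Multiset T) (hs : ∀ p ∈ s, Irreducible p) :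
    s.prod ≠ 0 ∧ weight s.prod = 2 * Multiset.card s := by
  induction s using Multiset.induction with
  | empty => simp [weight_one]
  | cons p s ih =>
    obtain ⟨h0, hw⟩ := ih fun q hq => hs q (Multiset.mem_cons_of_mem hq)
    have hp := hs p (Multiset.mem_cons_self p s)
    rw [Multiset.prod_cons]
    refine ⟨mul_ne_zero hp.ne_zero h0, ?_⟩
    rw [weight_mul hp.ne_zero h0, hw, weight_irreducible h2 hp, Multiset.card_cons]
    ring

end ClassNumberTwo

/-! ### The order is half-factorial. -/

namespace IsCubicGenerator

variable {T : Type*} [CommRing T] {a : T}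

/-- If y is outside P, a unit moves y into the order, and the complementary factor follows by
`mem_order_of_mul_mem`. If y is in P², all its multiples are in the order, and the unit can be spent
on z. -/
theorem not_irreducible_of_factor (h : IsCubicGenerator a) {x : order a} {y z : T}
    (e : (x : T) = y * z) (hy : ¬ IsUnit y) (hz : ¬ IsUnit z)
    (hyP : y ∉ primeIdeal a ∨ y ∈ primeIdeal a ^ 2) : ¬ Irreducible x := by
  have key : ∀ y' z' : order a, (y' : T) * z' = x → ¬ IsUnit (y' : T) → ¬ IsUnit (z' : T) →
      ¬ Irreducible x := fun y' z' e' hy' hz' hx => by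
    rw [h.isUnit_coe_order] at hy' hz'
    exact (hx.isUnit_or_isUnit (Subtype.ext e'.symm)).elim hy' hz'
  rcases hyP with hyP | hyP
  · obtain ⟨ε, hε⟩ := h.exists_unit_mul_mem_order y
    have hεP : ε * y ∉ primeIdeal a := by rwa [Ideal.unit_mul_mem_iff_mem _ ε.isUnit]
    have e' : (ε * y) * (ε⁻¹ * z : T) = x := by
      rw [mul_mul_mul_comm, Units.mul_inv, one_mul, e]
    have hz' := h.mem_order_of_mul_mem hε hεP (e'.symm ▸ x.2)
    exact key ⟨_, hε⟩ ⟨_, hz'⟩ e' (by simpa using hy) (by simpa using hz)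
  · obtain ⟨ε, hε⟩ := h.exists_unit_mul_mem_order z
    have e' : (ε⁻¹ * y : T) * (ε * z) = x := by
      rw [mul_mul_mul_comm, Units.inv_mul, one_mul, e]
    exact key ⟨_, mem_order_of_mem (Ideal.mul_mem_left _ _ hyP)⟩ ⟨_, hε⟩ e' (by simpa using hy)
      (by simpa using hz)

variable [IsDedekindDomain T]

/-- Irreducible elements of the order stay irreducible in `T`. -/
theorem irreducible_coe (h : IsCubicGenerator a) (hP : ∀ γ : T, primeIdeal a ≠ Ideal.span {γ})
    {x : order a} (hx : Irreducible x) : Irreducible (x : T) := by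
  refine ⟨fun hu => hx.not_isUnit (h.isUnit_coe_order.1 hu), fun {y z} e => ?_⟩
  by_contra! hyz
  obtain ⟨hy, hz⟩ := hyz
  by_cases hyP : y ∈ primeIdeal a; swap
  · exact h.not_irreducible_of_factor e hy hz (Or.inl hyP) hx
  by_cases hzP : z ∈ primeIdeal a; swap
  · exact h.not_irreducible_of_factor (e.trans (mul_comm _ _)) hz hy (Or.inl hzP) hx
  have hxP : (x : T) ∈ primeIdeal a ^ 2 := by
    rw [e, pow_two]
    exact Ideal.mul_mem_mul hyP hzP
  rw [h.primeIdeal_sq, Ideal.mem_span_singleton] at hxP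
  obtain ⟨t, ht⟩ := hxP
  -- With both factors in P, either x = bt is itself a usable factorization, or (y)(z) = P², which
  -- makes (y) = P principal.
  by_cases htu : IsUnit t; swap
  · exact h.not_irreducible_of_factor ht h.not_isUnit_squareGen htu (Or.inr h.squareGen_mem) hx
  obtain ⟨J, hJ⟩ := Ideal.dvd_span_singleton.2 hyP
  obtain ⟨M, hM⟩ := Ideal.dvd_span_singleton.2 hzP
  have e1 : (primeIdeal a * J) * (primeIdeal a * M) = primeIdeal a ^ 2 := by
    rw [← hJ, ← hM, Ideal.span_singleton_mul_span_singleton, ← e, ht,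
      Ideal.span_singleton_mul_right_unit htu, h.primeIdeal_sq]
  have e2 : primeIdeal a ^ 2 * (J * M) = primeIdeal a ^ 2 * 1 := by
    rw [mul_one]; conv_rhs => rw [← e1]
    ring
  have e3 := mul_left_cancel₀ (pow_ne_zero 2 h.primeIdeal_ne_zero) e2
  have hJu : J = ⊤ := Ideal.isUnit_iff.1 (IsUnit.of_mul_eq_one _ e3)
  exact hP y (by rw [hJ, hJu, Ideal.mul_top])

theorem isHalfFactorialDomain_order [Module.Finite ℤ T] (h : IsCubicGenerator a)
    (hP : ∀ γ : T, primeIdeal a ≠ Ideal.span {γ})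
    (h2 : ∀ I J : Ideal T, ¬ I.IsPrincipal → ¬ J.IsPrincipal → (I * J).IsPrincipal) :
    IsHalfFactorialDomain (order a) := by
  have hfin : Module.Finite ℤ (order a) :=
    Module.Finite.of_injective ((order a).subtype.toAddMonoidHom.toIntLinearMap)
      Subtype.val_injective
  have hnoeth : IsNoetherianRing (order a) := IsNoetherianRing.of_finite ℤ _
  refine ⟨inferInstance, fun x hx0 hxu => ?_, fun s t hs ht e => ?_⟩
  · obtain ⟨f, hf, e, -⟩ := (WfDvdMonoid.not_isUnit_iff_exists_factors_eq x hx0).1 hxu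
    exact ⟨f, hf, e⟩
  · have key : ∀ s : Multiset (order a), (∀ p ∈ s, Irreducible p) →
        weight ((s.prod : order a) : T) = 2 * Multiset.card s := fun s hs => by
      have := (weight_prod h2 (s.map (order a).subtype) fun p hp => by
        obtain ⟨q, hq, rfl⟩ := Multiset.mem_map.1 hp
        exact h.irreducible_coe hP (hs q hq)).2
      rwa [← map_multiset_prod, Multiset.card_map] at this
    have h1 := key s hs
    rw [e, key t ht] at h1
    omega

end IsCubicGenerator

/-! ### Irreducible power series, and the failure of half-factoriality. -/

namespace IsCubicGenerator

variable {T : Type*} [CommRing T] {a : T}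

theorem mem_primeIdeal_of_three_mul_mem (h : IsCubicGenerator a) {y : T}
    (hy : 3 * y ∈ primeIdeal a ^ 2) : y ∈ primeIdeal a := by
  obtain ⟨u, v, w, rfl⟩ := h.exists_coord y
  rw [show (3 * (u + v * a + w * a ^ 2) : T) = ((3 * u : ℤ) : T) + ((3 * v : ℤ) : T) * a +
    ((3 * w : ℤ) : T) * a ^ 2 by push_cast; ring, h.mem_primeIdeal_sq_iff] at hy
  rw [h.mem_primeIdeal_iff]
  omega

/-- ℤ + P is the preimage of the subfield 𝔽₃ of 𝔽₉, so it is closed under inverses. -/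
theorem mem_intAddIdeal_of_mul_eq_one (h : IsCubicGenerator a) {s u : T} (e : s * u = 1)
    (hu : u ∈ intAddIdeal (primeIdeal a)) : s ∈ intAddIdeal (primeIdeal a) := by
  obtain ⟨m, p, hp, rfl⟩ := hu
  have hm : ¬ 3 ∣ m := fun hm => h.primeIdeal_isPrime.ne_top ((Ideal.eq_top_iff_one _).2 (by
    rw [← e]
    exact Ideal.mul_mem_left _ _
      (Ideal.add_mem _ ((h.intCast_mem_primeIdeal_iff m).2 hm) hp)))
  obtain ⟨t, k, ht⟩ := (Int.prime_three.coprime_iff_not_dvd.2 hm).symm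
  have ht' : (t * m + k * 3 : T) = 1 := by exact_mod_cast congrArg (Int.cast : ℤ → T) ht
  refine ⟨t, (s * k) * 3 - t * s * p, Ideal.sub_mem _ (Ideal.mul_mem_left _ _ three_mem)
    (Ideal.mul_mem_left _ _ hp), ?_⟩
  linear_combination t * e - s * ht'

theorem order_le (a : T) : order a ≤ intAddIdeal (primeIdeal a) := by
  rintro x ⟨n, y, hy, rfl⟩
  exact ⟨n, y, Ideal.pow_le_self two_ne_zero hy, rfl⟩

theorem mem_intAddIdeal_of_mem {x : T} (hx : x ∈ primeIdeal a) :
    x ∈ intAddIdeal (primeIdeal a) := ⟨0, x, hx, by simp⟩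

/-- The coefficient equations of a factorization of `(3 + c x)(2 - 4a + a²)` over the order force
`c` to be congruent to an integer modulo `(3, 2 + 2a + a²)`. -/
theorem mem_intAddIdeal_of_factorization [IsDomain T] (h : IsCubicGenerator a)
    {c g₀ g₁ h₀ h₁ s u : T}
    (hsu : s * u = 1) (hg₀ : g₀ = squareGen a * s) (hh₀ : h₀ = 3 * u)
    (mh₀ : h₀ ∈ order a) (mh₁ : h₁ ∈ order a) (mg₁ : g₁ ∈ order a)
    (e : g₀ * h₁ + g₁ * h₀ = c * squareGen a) : c ∈ intAddIdeal (primeIdeal a) := by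
  have hw := h.squareGen_mul_cofactor
  -- 3u = n + y with y in P² forces 3 to divide n; as P divides 3 only once, u - n/3 lies in P.
  have hu : u ∈ intAddIdeal (primeIdeal a) := by
    obtain ⟨n, y, hy, e0⟩ := mh₀
    have hn : (n : T) ∈ primeIdeal a := by
      rw [show (n : T) = u * 3 - y by linear_combination hh₀ - e0]
      exact Ideal.sub_mem _ (Ideal.mul_mem_left _ _ three_mem) (Ideal.pow_le_self two_ne_zero hy)
    obtain ⟨m, rfl⟩ := (h.intCast_mem_primeIdeal_iff n).1 hn
    refine ⟨m, u - m, h.mem_primeIdeal_of_three_mul_mem ?_, by ring⟩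
    convert hy using 1
    push_cast at e0
    linear_combination e0 - hh₀
  have hs := h.mem_intAddIdeal_of_mul_eq_one hsu hu
  have hg₁u : g₁ * u ∈ primeIdeal a := h.mem_primeIdeal_of_three_mul_mem (by
    rw [show 3 * (g₁ * u) = (c - s * h₁) * squareGen a by
      linear_combination e - h₁ * hg₀ - g₁ * hh₀]
    exact Ideal.mul_mem_left _ _ h.squareGen_mem)
  have hg₁P : g₁ ∈ primeIdeal a := by
    rw [show g₁ = s * (g₁ * u) by linear_combination -g₁ * hsu]
    exact Ideal.mul_mem_left _ _ hg₁u
  obtain ⟨n, y, hy, e1⟩ := mg₁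
  have hn : (n : T) ∈ primeIdeal a := by
    rw [show (n : T) = g₁ - y by linear_combination -e1]
    exact Ideal.sub_mem _ hg₁P (Ideal.pow_le_self two_ne_zero hy)
  obtain ⟨k, rfl⟩ := (h.intCast_mem_primeIdeal_iff n).1 hn
  rw [h.primeIdeal_sq, Ideal.mem_span_singleton] at hy
  obtain ⟨r, rfl⟩ := hy
  -- This is the coefficient equation divided by b, after g₁ = 3k + br and 9 = b(8 + a + 2a²); every
  -- term on the right lies in ℤ + P.
  have hc : c = s * h₁ + (8 + a + 2 * a ^ 2) * u * k + 3 * (u * r) := by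
    apply mul_left_cancel₀ h.squareGen_ne_zero
    push_cast at e1
    linear_combination -e + h₁ * hg₀ + g₁ * hh₀ + 3 * u * e1 - u * k * hw
  have hwS : (8 + a + 2 * a ^ 2 : T) ∈ intAddIdeal (primeIdeal a) := by
    refine ⟨1, 7 + a + 2 * a ^ 2, ?_, by push_cast; ring⟩
    convert (h.mem_primeIdeal_iff 7 1 2).2 (by norm_num) using 1
    push_cast
    ring
  rw [hc]
  exact add_mem (add_mem (mul_mem hs (order_le a mh₁)) (mul_mem (mul_mem hwS hu)
    (intCast_mem _ k))) (mem_intAddIdeal_of_mem (Ideal.mul_mem_right _ _ three_mem))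

theorem exists_powerSeries_map_eq (h : IsCubicGenerator a) (c : T) : ∃ f : (order a)⟦X⟧,
    PowerSeries.map (order a).subtype f =
      (PowerSeries.C 3 + PowerSeries.C c * PowerSeries.X) * PowerSeries.C (squareGen a) := by
  have hb : ∀ t : T, t * squareGen a ∈ order a := fun t =>
    mem_order_of_mem (Ideal.mul_mem_left _ _ h.squareGen_mem)
  refine ⟨PowerSeries.C ⟨_, hb 3⟩ + PowerSeries.C ⟨_, hb c⟩ * PowerSeries.X, ?_⟩
  rw [map_add, map_mul, PowerSeries.map_C, PowerSeries.map_C, PowerSeries.map_X]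
  simp only [Subring.subtype_apply, map_mul]
  ring

theorem notMem_intAddIdeal_primeIdeal (h : IsCubicGenerator a) :
    a ∉ intAddIdeal (primeIdeal a) := by
  rintro ⟨n, y, hy, e⟩
  refine h.sub_intCast_notMem_primeIdeal n ?_
  rwa [sub_eq_of_eq_add' e]

variable [IsDedekindDomain T]

theorem span_three_isPrime (h : IsCubicGenerator a)
    (hP : ∀ γ : T, primeIdeal a ≠ Ideal.span {γ}) :
    Prime (Ideal.span {((3 : ℤ) : T), a + 1}) := by
  have htop : Ideal.span {((3 : ℤ) : T), a + 1} ≠ ⊤ := fun e => hP 3 (by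
    rw [← h.primeIdeal_mul_span_three, e, Ideal.mul_top])
  obtain ⟨M, hM, hle⟩ := Ideal.exists_le_maximal _ htop
  rw [Ideal.span_le, Set.pair_subset_iff] at hle
  rw [← h.eq_span_of_add_one_mem Int.prime_three hM.ne_top hle.1 hle.2]
  refine Ideal.prime_of_isPrime (fun e => ?_) hM.isPrime
  subst e
  exact h.three_ne_zero (by simpa using hle.1)

/-- A factorization of `3(2 - 4a + a²)` into nonunits is the obvious one up to units. -/
theorem factorization_three_mul_squareGen (h : IsCubicGenerator a)
    (hP : ∀ γ : T, primeIdeal a ≠ Ideal.span {γ}) {y z : T} (e : y * z = 3 * squareGen a)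
    (hy : ¬ IsUnit y) (hz : ¬ IsUnit z) :
    (∃ s u : T, s * u = 1 ∧ y = squareGen a * s ∧ z = 3 * u) ∨
      ∃ s u : T, s * u = 1 ∧ z = squareGen a * s ∧ y = 3 * u := by
  have hQ := h.span_three_isPrime hP
  have hPQ := h.primeIdeal_mul_span_three
  set Q := Ideal.span {((3 : ℤ) : T), a + 1}
  have hPp : Prime (primeIdeal a) :=
    Ideal.prime_of_isPrime h.primeIdeal_ne_zero h.primeIdeal_isPrime
  -- If P did not divide (y), then (y) would divide Q, so y would be a unit or (y) = Q; in the
  -- latter case PQ = (3) would make P principal.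
  have nP : ∀ {y z : T}, y * z = 3 * squareGen a → ¬ IsUnit y → y ∈ primeIdeal a := by
    intro y z e hy
    by_contra hyP
    have hd : ¬ primeIdeal a ∣ Ideal.span {y} := by rwa [Ideal.dvd_span_singleton]
    have e1 : Ideal.span {y} * Ideal.span {z} = primeIdeal a ^ 3 * Q := by
      rw [Ideal.span_singleton_mul_span_singleton, e, ← Ideal.span_singleton_mul_span_singleton,
        ← hPQ, ← h.primeIdeal_sq]
      ring
    obtain ⟨J, hJ⟩ := hPp.pow_dvd_of_dvd_mul_left 3 hd ⟨Q, e1⟩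
    have e2 : Ideal.span {y} * J = Q := by
      apply mul_left_cancel₀ (pow_ne_zero 3 hPp.ne_zero)
      rw [← e1, hJ]
      ring
    rcases hQ.irreducible.isUnit_or_isUnit e2.symm with hu | hu
    · exact hy (Ideal.span_singleton_eq_top.1 (Ideal.isUnit_iff.1 hu))
    · rw [Ideal.isUnit_iff.1 hu, Ideal.mul_top] at e2
      have h3 : (3 : T) ∈ Ideal.span {y} := by
        rw [e2]; exact Ideal.subset_span (by simp)
      obtain ⟨t, ht⟩ := Ideal.mem_span_singleton.1 h3
      refine hP t ?_
      apply mul_left_cancel₀ hQ.ne_zero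
      rw [mul_comm Q, hPQ, ← e2, Ideal.span_singleton_mul_span_singleton, ht]
  have key : ∀ {y z : T} {J J' : Ideal T}, y * z = 3 * squareGen a →
      Ideal.span {y} = primeIdeal a * J → Ideal.span {z} = primeIdeal a * J' →
      J * J' = primeIdeal a * Q → primeIdeal a ∣ J →
      ∃ s u : T, s * u = 1 ∧ y = squareGen a * s ∧ z = 3 * u := by
    rintro y z J J' e hJ hJ' e1 ⟨M, rfl⟩
    have e2 : M * J' = Q := by
      apply mul_left_cancel₀ hPp.ne_zero
      rw [← e1, mul_assoc]
    rcases hQ.irreducible.isUnit_or_isUnit e2.symm with hu | hu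
    · rw [Ideal.isUnit_iff.1 hu, Ideal.mul_top, ← pow_two, h.primeIdeal_sq] at hJ
      obtain ⟨s, hs⟩ := Ideal.span_singleton_eq_span_singleton.1 hJ.symm
      refine ⟨s, (s⁻¹ : Tˣ), s.mul_inv, hs.symm, ?_⟩
      apply mul_left_cancel₀ h.squareGen_ne_zero
      rw [← hs] at e
      have := s.mul_inv
      linear_combination (s⁻¹ : Tˣ) * e - squareGen a * z * this
    · rw [Ideal.isUnit_iff.1 hu, Ideal.mul_top] at hJ'
      exact absurd hJ'.symm (hP z)
  obtain ⟨J, hJ⟩ := Ideal.dvd_span_singleton.2 (nP e hy)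
  obtain ⟨J', hJ'⟩ := Ideal.dvd_span_singleton.2 (nP ((mul_comm z y).trans e) hz)
  have e1 : J * J' = primeIdeal a * Q := by
    apply mul_left_cancel₀ (pow_ne_zero 2 hPp.ne_zero)
    calc primeIdeal a ^ 2 * (J * J') = Ideal.span {y} * Ideal.span {z} := by rw [hJ, hJ']; ring
      _ = _ := by
        rw [Ideal.span_singleton_mul_span_singleton, e,
          ← Ideal.span_singleton_mul_span_singleton, ← hPQ, ← h.primeIdeal_sq]
        ring
  rcases hPp.dvd_or_dvd (Dvd.intro _ e1.symm) with hd | hd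
  · exact Or.inl (key e hJ hJ' e1 hd)
  · exact Or.inr (key ((mul_comm z y).trans e) hJ' hJ ((mul_comm J' J).trans e1) hd)

/-- The power series `3(2 - 4a + a²) + c(2 - 4a + a²)x` is irreducible over the order unless `c` is
congruent to an integer modulo `(3, 2 + 2a + a²)`. -/
theorem irreducible_powerSeries (h : IsCubicGenerator a)
    (hP : ∀ γ : T, primeIdeal a ≠ Ideal.span {γ}) {c : T} (hc : c ∉ intAddIdeal (primeIdeal a))
    {f : (order a)⟦X⟧} (hf : PowerSeries.map (order a).subtype f =
      (PowerSeries.C 3 + PowerSeries.C c * PowerSeries.X) * PowerSeries.C (squareGen a)) :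
    Irreducible f := by
  have hu : ∀ g : (order a)⟦X⟧, IsUnit g ↔ IsUnit ((PowerSeries.coeff 0 g : order a) : T) :=
    fun g => by
      rw [h.isUnit_coe_order, PowerSeries.isUnit_iff_constantCoeff,
        PowerSeries.coeff_zero_eq_constantCoeff]
  have f0 : ((PowerSeries.coeff 0 f : order a) : T) = 3 * squareGen a := by
    have := congrArg (PowerSeries.coeff 0) hf
    rw [PowerSeries.coeff_map] at this
    simpa using this
  have f1 : ((PowerSeries.coeff 1 f : order a) : T) = c * squareGen a := by
    have := congrArg (PowerSeries.coeff 1) hf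
    rw [PowerSeries.coeff_map, PowerSeries.coeff_mul_C] at this
    simpa [PowerSeries.coeff_C] using this
  refine ⟨fun hfu => ?_, fun {g k} e => ?_⟩
  · rw [hu, f0, IsUnit.mul_iff] at hfu
    exact h.not_isUnit_three hfu.1
  · by_contra! hgk
    rw [hu, hu] at hgk
    have e0 : ((PowerSeries.coeff 0 g : order a) : T) * (PowerSeries.coeff 0 k : order a) =
        3 * squareGen a := by
      rw [← f0, e]
      simp
    have e1 : ((PowerSeries.coeff 0 g : order a) : T) * (PowerSeries.coeff 1 k : order a) +
        (PowerSeries.coeff 1 g : order a) * (PowerSeries.coeff 0 k : order a) =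
        c * squareGen a := by
      rw [← f1, e, PowerSeries.coeff_one_mul]
      simp
      ring
    rcases h.factorization_three_mul_squareGen hP e0 hgk.1 hgk.2 with
      ⟨s, u, hsu, h1, h2⟩ | ⟨s, u, hsu, h1, h2⟩
    · exact hc (h.mem_intAddIdeal_of_factorization hsu h1 h2 (PowerSeries.coeff 0 k).2
        (PowerSeries.coeff 1 k).2 (PowerSeries.coeff 1 g).2 e1)
    · exact hc (h.mem_intAddIdeal_of_factorization hsu h1 h2 (PowerSeries.coeff 0 g).2
        (PowerSeries.coeff 1 g).2 (PowerSeries.coeff 1 k).2 (by rw [← e1]; ring))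

theorem not_isHalfFactorialDomain_powerSeries (h : IsCubicGenerator a)
    (hP : ∀ γ : T, primeIdeal a ≠ Ideal.span {γ}) : ¬ IsHalfFactorialDomain (order a)⟦X⟧ := by
  intro H
  have hinj : Function.Injective (PowerSeries.map (order a).subtype) :=
    PowerSeries.map_injective _ Subtype.val_injective
  have hu : ∀ g : (order a)⟦X⟧, IsUnit g → IsUnit ((PowerSeries.coeff 0 g : order a) : T) :=
    fun g hg => by
      rw [h.isUnit_coe_order, PowerSeries.coeff_zero_eq_constantCoeff]
      exact hg.map PowerSeries.constantCoeff
  -- 4 - a is the other root of t² - 4t + 2 modulo b: its sum with a is 4 and its product with a is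
  -- 2 - b, so (3 + ax)(3 + (4 - a)x) has coefficients in the order.
  have hc' : 4 - a ∉ intAddIdeal (primeIdeal a) := fun hm => h.notMem_intAddIdeal_primeIdeal (by
    have := sub_mem (intCast_mem (intAddIdeal (primeIdeal a)) 4) hm
    convert this using 1
    push_cast
    ring)
  obtain ⟨f, hf⟩ := h.exists_powerSeries_map_eq a
  obtain ⟨f', hf'⟩ := h.exists_powerSeries_map_eq (4 - a)
  have hfi := h.irreducible_powerSeries hP h.notMem_intAddIdeal_primeIdeal hf
  have hfi' := h.irreducible_powerSeries hP hc' hf'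
  let b : (order a)⟦X⟧ := PowerSeries.C ⟨squareGen a, mem_order_of_mem h.squareGen_mem⟩
  let k : (order a)⟦X⟧ := PowerSeries.C 9 + PowerSeries.C 12 * PowerSeries.X +
    PowerSeries.C (2 - ⟨squareGen a, mem_order_of_mem h.squareGen_mem⟩) * PowerSeries.X ^ 2
  have hb : PowerSeries.map (order a).subtype b = PowerSeries.C (squareGen a) :=
    PowerSeries.map_C _ _
  have hk : PowerSeries.map (order a).subtype k =
      (PowerSeries.C 3 + PowerSeries.C a * PowerSeries.X) *
        (PowerSeries.C 3 + PowerSeries.C (4 - a) * PowerSeries.X) := by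
    simp only [k, map_add, map_mul, map_pow, map_sub, PowerSeries.map_C, PowerSeries.map_X,
      Subring.subtype_apply, squareGen, map_ofNat]
    ring
  have e : f * f' = b * (b * k) := hinj (by
    simp only [map_mul, hf, hf', hb, hk]
    ring)
  have hb0 : b ≠ 0 := fun e0 => h.squareGen_ne_zero (by
    have := congrArg (fun g => ((PowerSeries.coeff 0 g : order a) : T)) e0
    simpa [b] using this)
  have hbu : ¬ IsUnit b := fun hbu => h.not_isUnit_squareGen (by
    simpa [b] using hu b hbu)
  have hk9 : ((PowerSeries.coeff 0 k : order a) : T) = 3 * 3 := by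
    simp [k]
    exact (map_ofNat (order a).subtype 9).trans (by norm_num)
  have hk0 : k ≠ 0 := fun e0 => mul_ne_zero h.three_ne_zero h.three_ne_zero (by
    rw [← hk9, e0]
    simp)
  have hku : ¬ IsUnit k := fun hku => h.not_isUnit_three (by
    have := hu k hku
    rw [hk9, IsUnit.mul_iff] at this
    exact this.1)
  obtain ⟨s, hs, hsb⟩ := H.atomic b hb0 hbu
  obtain ⟨t, ht, htk⟩ := H.atomic k hk0 hku
  have hs0 : Multiset.card s ≠ 0 := fun e0 => hbu (by
    rw [← hsb, Multiset.card_eq_zero.1 e0]; simp)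
  have ht0 : Multiset.card t ≠ 0 := fun e0 => hku (by
    rw [← htk, Multiset.card_eq_zero.1 e0]; simp)
  have := H.length_eq {f, f'} (s + (s + t)) (by simp [hfi, hfi'])
    (by
      simp only [Multiset.mem_add]
      rintro q (hq | hq | hq)
      exacts [hs q hq, hs q hq, ht q hq]) (by simp [e, hsb, htk])
  simp only [Multiset.card_add, Multiset.card_pair] at this
  omega

end IsCubicGenerator

/-! ### The order inside K, its integral closure, and the assembly. -/

section NumberField

open IsCubicGenerator

variable {K : Type*} [Field K]

/-- `ℤ + (3, 2 + 2a + a²)²` is an order in `K`. -/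
theorem IsCubicGenerator.isNumberFieldOrder_order [NumberField K] (a : 𝓞 K) :
    IsNumberFieldOrder ((order a).map (algebraMap (𝓞 K) K)) := by
  refine ⟨?_, ?_⟩
  · have hfg := (IsNoetherian.noetherian
      (AddSubgroup.toIntSubmodule (order a).toAddSubgroup)).map
        (algebraMap (𝓞 K) K).toAddMonoidHom.toIntLinearMap
    rw [Submodule.fg_iff_addSubgroup_fg] at hfg
    exact hfg
  · rw [eq_top_iff]
    rintro x -
    have hx : IsAlgebraic ℤ x :=
      (IsFractionRing.isAlgebraic_iff ℤ ℚ K).2 (Algebra.IsAlgebraic.isAlgebraic x)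
    obtain ⟨n, hn, hi⟩ := hx.exists_integral_multiple
    let y : 𝓞 K := ⟨n • x, hi⟩
    have hy : algebraMap (𝓞 K) K y = n * x := zsmul_eq_mul x n
    have hm : algebraMap (𝓞 K) K (y * 3 ^ 2) ∈ (order a).map (algebraMap (𝓞 K) K) :=
      ⟨_, mem_order_of_mem (Ideal.mul_mem_left _ _ (Ideal.pow_mem_pow three_mem 2)), rfl⟩
    -- 9 lies in P², so 9y lies in the order for every integral y.
    have e : x = ((n * 9 : ℚ)⁻¹) • algebraMap (𝓞 K) K (y * 3 ^ 2) := by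
      have hn' : (n : K) ≠ 0 := by exact_mod_cast hn
      rw [map_mul, hy, map_pow, map_ofNat, Algebra.smul_def, map_inv₀, map_mul, map_intCast,
        map_ofNat]
      field_simp
      norm_num
    rw [e]
    exact Submodule.smul_mem _ _ (Submodule.subset_span hm)

theorem IsCubicGenerator.isIntegralClosure_order (a : 𝓞 K) :
    IsIntegralClosure (𝓞 K) (order a) K := by
  refine ⟨FaithfulSMul.algebraMap_injective _ _, fun {x} => ⟨fun hx => ?_, ?_⟩⟩
  · have : Algebra.IsIntegral ℤ (order a) := ⟨fun y => by
      have := NumberField.RingOfIntegers.isIntegral (y : 𝓞 K)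
      exact (isIntegral_algHom_iff ((order a).subtype.toIntAlgHom) Subtype.val_injective).1 this⟩
    exact ⟨⟨x, isIntegral_trans (R := ℤ) x hx⟩, rfl⟩
  · rintro ⟨y, rfl⟩
    have := (NumberField.RingOfIntegers.isIntegral_coe y).tower_top (A := order a)
    exact this

end NumberField

theorem mainTheorem4 {K : Type*} [Field K] [NumberField K] (α : K)
    (hα : α ^ 3 + 4 * α - 1 = 0) (hK : IntermediateField.adjoin ℚ {α} = ⊤)
    (a : 𝓞 K) (ha : a = rootInt α hα)
    (P : Ideal (𝓞 K)) (hP : P = Ideal.span {3, 2 + 2 * a + a ^ 2})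
    (R : Subring (𝓞 K)) (hR : R = intAddIdeal (P ^ 2)) :
    -- `R` is an order in `K` whose integral closure in `K` is `𝓞 K`
    IsNumberFieldOrder (R.map (algebraMap (𝓞 K) K)) ∧
    IsIntegralClosure (𝓞 K) R K ∧
    -- `P` is a prime ideal, and the conductor of `R` is `P ^ 2`, which is not radical
    P.IsPrime ∧
    conductorIdeal R = P ^ 2 ∧
    P ^ 2 = Ideal.span {2 - 4 * a + a ^ 2} ∧
    ¬ (conductorIdeal R).IsRadical ∧
    -- `R` is an HFD but `R⟦X⟧` is not
    IsHalfFactorialDomain R ∧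
    ¬ IsHalfFactorialDomain R⟦X⟧ ∧
    -- the witness: irreducible over `R`, but a product of two nonunits over `𝓞 K`
    ∃ f : R⟦X⟧,
      PowerSeries.map R.subtype f =
        PowerSeries.C (6 - 12 * a + 3 * a ^ 2) +
          PowerSeries.C (1 - 2 * a - 4 * a ^ 2) * PowerSeries.X ∧
      Irreducible f ∧
      PowerSeries.map R.subtype f =
        (PowerSeries.C 3 + PowerSeries.C a * PowerSeries.X) *
          PowerSeries.C (2 - 4 * a + a ^ 2) ∧
      ¬ IsUnit (PowerSeries.C 3 + PowerSeries.C a * PowerSeries.X : (𝓞 K)⟦X⟧) ∧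
      ¬ IsUnit (PowerSeries.C (2 - 4 * a + a ^ 2) : (𝓞 K)⟦X⟧) := by
  have h : IsCubicGenerator a := ha ▸ isCubicGenerator_rootInt hα hK
  have hnp : ∀ γ : 𝓞 K, IsCubicGenerator.primeIdeal a ≠ Ideal.span {γ} :=
    ha ▸ primeIdeal_not_isPrincipal hα hK
  change P = IsCubicGenerator.primeIdeal a at hP
  subst hP hR
  obtain ⟨f, hf⟩ := h.exists_powerSeries_map_eq a
  refine ⟨IsCubicGenerator.isNumberFieldOrder_order a, IsCubicGenerator.isIntegralClosure_order a,
    h.primeIdeal_isPrime,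
    h.conductorIdeal_order, h.primeIdeal_sq, ?_,
    h.isHalfFactorialDomain_order hnp fun I J => isPrincipal_mul_of_not_isPrincipal hα hK,
    h.not_isHalfFactorialDomain_powerSeries hnp, f, ?_,
    h.irreducible_powerSeries hnp h.notMem_intAddIdeal_primeIdeal hf, hf, ?_, ?_⟩
  · rw [h.conductorIdeal_order]
    exact h.primeIdeal_sq_not_isRadical
  · have e : 1 - 2 * a - 4 * a ^ 2 = a * (2 - 4 * a + a ^ 2) := by linear_combination -h.root
    rw [hf, IsCubicGenerator.squareGen, e,
      show 6 - 12 * a + 3 * a ^ 2 = 3 * (2 - 4 * a + a ^ 2) by ring, map_mul, map_mul]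
    ring
  · rw [PowerSeries.isUnit_iff_constantCoeff]
    simpa using h.not_isUnit_three
  · rw [PowerSeries.isUnit_iff_constantCoeff, PowerSeries.constantCoeff_C]
    exact h.not_isUnit_squareGen
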